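/- **Setting.** Let $\Omega\subset\mathbb R^2$ be a polygonal domain (connected, and equal to the interior of the union of the elements below), and let $\Gamma\subset\Omega$ be a simple closed regular $C^2$ curve. It separates the plane into two open sets $D^+,D^-$; put $S^\pm=S\cap D^\pm$ for sets $S$. Let $\beta=\beta^\pm>0$ on $D^\pm$ and $\{\beta\}=(\beta^++\beta^-)/2$. Let $\mathcal T_h$ be a conforming triangulation of $\Omega$ into closed triangles $T$ of diameter $h_T$, $h=\max_T h_T$, shape regular with constant $\rho>0$: each $T$ contains a disc of diameter $\rho h_T$. Let $\mathring{\mathcal E}_h$ be the set of interior edges. Elements and edges that meet $\Gamma$ are called interface elements $\mathcal T_h^i$ and interface edges $\mathring{\mathcal E}_h^i$; the other interior edges form $\mathring{\mathcal E}_h^n$; $\mathcal F_h^i$ is the set of edges of interface elements. Put $\Gamma_T=\Gamma\cap T$. An interior edge $e$ is shared by $T_e^1,T_e^2$, its unit normal $n$ points from $T_e^1$ to $T_e^2$, and on $e$ we write $[w]=w|_{T_e^1}-w|_{T_e^2}$, $\{w\}=\frac12(w|_{T_e^1}+w|_{T_e^2})$. On $\Gamma$, $[w]=w^+-w^-$,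 and $n$, $t$ are the unit normal and tangent of $\Gamma$. Also $\partial_{nn}w=\sum_{i,j} n_in_j\partial_{ij}w$, $\partial_{ntt}w=\sum_{i,j,k} n_it_jt_k\partial_{ijk}w$. Assume: (H1) $\Gamma$ meets an edge in at most two points unless the edge is part of $\Gamma$; (H2) any two distinct points of $\Gamma\cap\partial T$ lie on two different edges of $T$ (so no edge is contained in $\Gamma$ and each open edge is met at most once); (H3) for some $r>0$ the segments of length $2r$ centered at the points of $\Gamma$ and perpendicular to $\Gamma$ are pairwise disjoint, and $h<r/2$. **Space.** Let $p\ge1$, $\lambda\ge1$, $\omega_0,\dots,\omega_3>0$. For $T\in\mathcal T_h$ with barycenter $O$ let $A_i$, $i\in\mathcal I_p$, be the Lagrange nodes of degree $p$, $\psi_i\in\mathcal P_p$ the Lagrange shape functions, $\psi_i(A_j)=\delta_{ij}$, and $T_\lambda=\{O+\lambda(Y-O):Y\in T\}$. If $T$ is not an interface element, $S_h^p(T)=\mathcal P_p$. If it is, let $\xi_i$ be the pair in $\mathcal P_p\times\mathcal P_p$ (first entry used on $T^+$, second on $T^-$) with entry $\psi_i$ on the side of $A_i$ and $0$ on the other,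 and $\eta_i$ the pair with these two entries exchanged (a node on $\Gamma$ is assigned to either side, the same one for all elements). Define $$\begin{aligned}\mathcal J(u,v)=\int_{T_\lambda\cap\Gamma}\big(&\omega_0[u][v]+\omega_1h^2[\partial_nu][\partial_nv]+\omega_2h^4[\beta\partial_{nn}u][\beta\partial_{nn}v]\\&+\omega_3h^6[\beta(\partial_n\Delta u+\partial_{ntt}u)][\beta(\partial_n\Delta v+\partial_{ntt}v)]\big)ds.\end{aligned}$$ Then $S_h^p(T)$ is the set of all $\varphi=\sum_iv_i\xi_i+\sum_ic_i\eta_i$ with $v_i,c_i\in\mathbb R$ and $\mathcal J(\varphi,\eta_j)=0$ for all $j\in\mathcal I_p$. The space $S_h^p$ consists of all $u$ with $u|_T\in S_h^p(T)$ for all $T$, $u$ continuous on every $e\in\mathring{\mathcal E}_h^n$, $u$ continuous at all Lagrange nodes, and $u=0$ on $\partial\Omega$. **Form and norm.** Let $\sigma_u,\sigma_F,\sigma_n>0$. For edges in $\mathring{\mathcal E}_h^n$, $\beta$ is its constant value on the edge. A term with the factor $1/|e^s|$ is $0$ if $|e^s|=0$. Put $a_h=A_h+J_{h,u}+J_{h,n}$,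 where $$A_h(u,v)=\sum_{T\in\mathcal T_h}\int_T\beta\nabla^2u:\nabla^2v\,dX,$$ $$\begin{aligned}J_{h,u}(u,v)=&-\sum_{e\in\mathring{\mathcal E}_h}\int_e\{\beta\partial_{nn}u\}[\partial_nv]ds-\sum_{e\in\mathring{\mathcal E}_h}\int_e\{\beta\partial_{nn}v\}[\partial_nu]ds+\sum_{e\in\mathring{\mathcal E}_h^n}\frac{\sigma_u\beta}{|e|}\int_e[\partial_nu][\partial_nv]ds\\&+\sum_{e\in\mathring{\mathcal E}_h^i}\sum_{s=\pm}\frac{\sigma_u\beta^s}{|e^s|}\int_{e^s}[\partial_nu][\partial_nv]ds+\sum_{T\in\mathcal T_h^i}\frac{\sigma_u\{\beta\}}{h_T}\int_{\Gamma_T}[\partial_nu][\partial_nv]ds,\end{aligned}$$ $$\begin{aligned}J_{h,n}(u,v)=&\sum_{e\in\mathring{\mathcal E}_h^i}\sum_{s=\pm}\sigma_F|e^s|\beta^s\int_{e^s}[\partial_{nn}u][\partial_{nn}v]ds+\sum_{e\in\mathring{\mathcal E}_h^n\cap\mathcal F_h^i}\sigma_F|e|\beta\int_e[\partial_{nn}u][\partial_{nn}v]ds\\&+\sum_{e\in\mathring{\mathcal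 E}_h^i}\frac{\sigma_n\{\beta\}}{|e|^3}\int_e[u][v]ds+\sum_{T\in\mathcal T_h^i}\frac{\sigma_n\{\beta\}}{h_T^3}\int_{\Gamma_T}[u][v]ds,\end{aligned}$$ and $$\begin{aligned}\|v\|_h^2=&\sum_{T\in\mathcal T_h}\int_T\beta|\nabla^2v|^2dX+\sum_{e\in\mathring{\mathcal E}_h^n}\frac{\sigma_u\beta}{|e|}\|[\partial_nv]\|_{L^2(e)}^2+\sum_{T\in\mathcal T_h^i}\frac{\sigma_u\{\beta\}}{h_T}\|[\partial_nv]\|_{L^2(\Gamma_T)}^2\\&+\sum_{e\in\mathring{\mathcal E}_h^i}\sum_{s=\pm}\frac{\sigma_u\beta^s}{|e^s|}\|[\partial_nv]\|_{L^2(e^s)}^2+\sum_{e\in\mathring{\mathcal E}_h^n\cap\mathcal F_h^i}\sigma_F|e|\beta\|[\partial_{nn}v]\|_{L^2(e)}^2\\&+\sum_{e\in\mathring{\mathcal E}_h^i}\sum_{s=\pm}\sigma_F|e^s|\beta^s\|[\partial_{nn}v]\|_{L^2(e^s)}^2+\sum_{e\in\mathring{\mathcal E}_h^i}\frac{\sigma_n\{\beta\}}{|e|^3}\|[v]\|_{L^2(e)}^2+\sum_{T\in\mathcal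 T_h^i}\frac{\sigma_n\{\beta\}}{h_T^3}\|[v]\|_{L^2(\Gamma_T)}^2.\end{aligned}$$ Derivatives on interface elements are taken piecewise, on $T^+$ and $T^-$, and $|\nabla^2v|$ is the Frobenius norm. **Theorem (Continuity).** For all $p\ge1$, $\rho>0$ and $\sigma_u,\sigma_F,\sigma_n>0$ there is a constant $C>0$, depending only on these numbers (in particular neither on the interface and its location nor on $\Omega$, the mesh, $h$, $r$, $\beta^\pm$, $\lambda$ or the $\omega_i$), such that in every setting as above $$a_h(u,v)\le C\,\|u\|_h\,\|v\|_h\qquad\text{for all }u,v\in S_h^p.$$ -/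

import Mathlib

open MeasureTheory Set
open scoped BigOperators

namespace ImmersedC0IP

noncomputable section

/-- The Euclidean plane. -/
abbrev Plane := EuclideanSpace ℝ (Fin 2)

/-- Bivariate real polynomials. -/
abbrev Poly := MvPolynomial (Fin 2) ℝ

/-- Value of a polynomial at a point of the plane. -/
def val (q : Poly) (x : Plane) : ℝ := MvPolynomial.eval (fun i => x i) q

/-- First directional derivative `∂_a q = ∑ aᵢ ∂ᵢ q`. -/
def dir1 (a : Plane) (q : Poly) (x : Plane) : ℝ :=
  ∑ i, a i * val (MvPolynomial.pderiv i q) x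

/-- Second directional derivative `∂_{ab} q = ∑ aᵢ bⱼ ∂ᵢⱼ q`. -/
def dir2 (a b : Plane) (q : Poly) (x : Plane) : ℝ :=
  ∑ i, ∑ j, a i * b j * val (MvPolynomial.pderiv i (MvPolynomial.pderiv j q)) x

/-- Third directional derivative `∂_{abc} q = ∑ aᵢ bⱼ cₖ ∂ᵢⱼₖ q`. -/
def dir3 (a b c : Plane) (q : Poly) (x : Plane) : ℝ :=
  ∑ i, ∑ j, ∑ k, a i * b j * c k *
    val (MvPolynomial.pderiv i (MvPolynomial.pderiv j (MvPolynomial.pderiv k q))) x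

/-- The Laplacian. -/
def lap (q : Poly) : Poly := ∑ i, MvPolynomial.pderiv i (MvPolynomial.pderiv i q)

/-- The Frobenius product `∇²q : ∇²w`. -/
def hessProd (q w : Poly) (x : Plane) : ℝ :=
  ∑ i, ∑ j, val (MvPolynomial.pderiv i (MvPolynomial.pderiv j q)) x *
    val (MvPolynomial.pderiv i (MvPolynomial.pderiv j w)) x

/-! ### Triangular meshes -/

/-- The closed triangle, or the closed edge, with a given finite set of vertices. -/
def hull (T : Finset Plane) : Set Plane := convexHull ℝ (T : Set Plane)

/-- Length of a subset of the plane (one-dimensional Hausdorff measure). -/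
def length (S : Set Plane) : ℝ := (Measure.hausdorffMeasure 1 : Measure Plane).real S

/-- Integral along a subset of the plane with respect to arc length. -/
def lineInt (S : Set Plane) (f : Plane → ℝ) : ℝ :=
  ∫ x in S, f x ∂(Measure.hausdorffMeasure 1 : Measure Plane)

/-- A conforming triangulation: finitely many nondegenerate triangles, given by their vertices,
any two of which meet in a common face (possibly empty). -/
structure Triangulation where
  elems : Finset (Finset Plane)
  card_eq : ∀ T ∈ elems, T.card = 3
  indep : ∀ T ∈ elems, AffineIndependent ℝ (Subtype.val : T → Plane)
  conforming : ∀ S ∈ elems, ∀ T ∈ elems,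
    hull S ∩ hull T = convexHull ℝ ((S : Set Plane) ∩ (T : Set Plane))

/-- The diameter `h_T`. -/
def diamT (T : Finset Plane) : ℝ := Metric.diam (hull T)

/-- The mesh size `h`, the largest element diameter. -/
def Triangulation.meshSize (M : Triangulation) : ℝ := ⨆ T : {T // T ∈ M.elems}, diamT T.1

open Classical in
/-- All edges of the triangulation, given by their two endpoints. -/
def Triangulation.edges (M : Triangulation) : Finset (Finset Plane) :=
  M.elems.biUnion fun T => T.powersetCard 2

open Classical in
/-- Interior edges: those that belong to two different elements. -/
def Triangulation.intEdges (M : Triangulation) : Finset (Finset Plane) :=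
  M.edges.filter fun e => ∃ S ∈ M.elems, ∃ T ∈ M.elems, S ≠ T ∧ e ⊆ S ∧ e ⊆ T

/-- `Ω` is the polygonal domain that is triangulated by `M`. -/
def Triangulation.IsMeshOf (M : Triangulation) (Ω : Set Plane) : Prop :=
  IsConnected Ω ∧ Ω = interior (⋃ T ∈ M.elems, hull T)

/-- Shape regularity with constant `ρ`: every element `T` contains a disc of
diameter `ρ h_T`. -/
def Triangulation.ShapeRegular (M : Triangulation) (ρ : ℝ) : Prop :=
  ∀ T ∈ M.elems, ∃ c : Plane, Metric.closedBall c (ρ * diamT T / 2) ⊆ hull T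

/-- A triangulation together with a numbering `T_e¹ = first e`, `T_e² = second e` of the two
elements adjacent to each interior edge. -/
structure Mesh extends Triangulation where
  first : Finset Plane → Finset Plane
  second : Finset Plane → Finset Plane
  first_mem : ∀ e ∈ toTriangulation.intEdges, first e ∈ elems ∧ e ⊆ first e
  second_mem : ∀ e ∈ toTriangulation.intEdges, second e ∈ elems ∧ e ⊆ second e
  first_ne_second : ∀ e ∈ toTriangulation.intEdges, first e ≠ second e

/-- Barycenter of a triangle. -/
def barycenter (T : Finset Plane) : Plane := (3 : ℝ)⁻¹ • ∑ a ∈ T, a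

/-- The vector from the barycenter of `T_e¹` to that of `T_e²`, minus its component along `e`. -/
def Mesh.edgeNormalVec (M : Mesh) (e : Finset Plane) : Plane :=
  (vectorSpan ℝ (e : Set Plane))ᗮ.starProjection
    (barycenter (M.second e) - barycenter (M.first e))

/-- The unit normal `n_e` of an interior edge, oriented from `T_e¹` to `T_e²`. -/
def Mesh.edgeNormal (M : Mesh) (e : Finset Plane) : Plane :=
  ‖M.edgeNormalVec e‖⁻¹ • M.edgeNormalVec e

/-! ### Interfaces -/

/-- The two sides of the interface: `true` stands for `+`, `false` for `-`. -/
abbrev Side := Bool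

/-- A simple closed regular `C²` curve, given by a periodic parametrization `γ`, together with
the two open sets `region true`, `region false` into which it separates the plane.
The function `side` says on which side a point is counted; on the curve itself
(only nodes matter there) it is arbitrary. -/
structure Interface where
  γ : ℝ → Plane
  period : ℝ
  period_pos : 0 < period
  periodic : Function.Periodic γ period
  smooth : ContDiff ℝ 2 γ
  regular : ∀ t, deriv γ t ≠ 0
  simple : InjOn γ (Ico 0 period)
  region : Side → Set Plane
  region_open : ∀ s, IsOpen (region s)
  region_disjoint : Disjoint (region true) (region false)
  region_cover : region true ∪ region false = (range γ)ᶜ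
  separates : ∀ s, range γ ⊆ closure (region s)
  side : Plane → Side
  side_eq : ∀ s, ∀ x ∈ region s, side x = s

namespace Interface

variable (I : Interface)

/-- The curve `Γ` as a set. -/
def curve : Set Plane := range I.γ

/-- The unit tangent. -/
def tangent (t : ℝ) : Plane := ‖deriv I.γ t‖⁻¹ • deriv I.γ t

/-- The unit normal. -/
def normal (t : ℝ) : Plane := !₂[-(I.tangent t 1), I.tangent t 0]

/-- Arc length integral over `Γ ∩ S` of a function of the parameter. -/
def curveInt (S : Set Plane) (f : ℝ → ℝ) : ℝ :=
  ∫ t in {t | t ∈ Ico 0 I.period ∧ I.γ t ∈ S}, f t * ‖deriv I.γ t‖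

/-- The segment of length `2 r` centered at `γ t` and perpendicular to `Γ`. -/
def normalSegment (r t : ℝ) : Set Plane :=
  segment ℝ (I.γ t - r • I.normal t) (I.γ t + r • I.normal t)

/-- `r` is the radius of a tubular neighborhood of `Γ`: the perpendicular segments of
length `2 r` centered at different points of `Γ` are disjoint. -/
def TubularRadius (r : ℝ) : Prop :=
  0 < r ∧ ∀ t ∈ Ico 0 I.period, ∀ t' ∈ Ico 0 I.period, t ≠ t' →
    Disjoint (I.normalSegment r t) (I.normalSegment r t')

/-- An edge meets the interface in at most two points unless it is part of the interface. -/
def H1 (M : Triangulation) : Prop :=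
  ∀ e ∈ M.edges, hull e ⊆ I.curve ∨ (hull e ∩ I.curve).encard ≤ 2

/-- Two different points of intersection of the interface and the boundary of an element lie on
different edges of this element. -/
def H2 (M : Triangulation) : Prop :=
  ∀ T ∈ M.elems, ∀ x ∈ frontier (hull T) ∩ I.curve, ∀ y ∈ frontier (hull T) ∩ I.curve, x ≠ y →
    ∃ e ∈ T.powersetCard 2, ∃ e' ∈ T.powersetCard 2, e ≠ e' ∧ x ∈ hull e ∧ y ∈ hull e'

open Classical in
/-- The interface elements. -/
def elemsI (M : Triangulation) : Finset (Finset Plane) :=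
  M.elems.filter fun T => (hull T ∩ I.curve).Nonempty

open Classical in
/-- The interior interface edges. -/
def intEdgesI (M : Triangulation) : Finset (Finset Plane) :=
  M.intEdges.filter fun e => (hull e ∩ I.curve).Nonempty

open Classical in
/-- The interior non-interface edges. -/
def intEdgesN (M : Triangulation) : Finset (Finset Plane) :=
  M.intEdges.filter fun e => ¬ (hull e ∩ I.curve).Nonempty

open Classical in
/-- The interior non-interface edges that belong to an interface element. -/
def intEdgesNF (M : Triangulation) : Finset (Finset Plane) :=
  (I.intEdgesN M).filter fun e => ∃ T ∈ I.elemsI M, e ⊆ T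

/-- The part `e^s` of an edge, or `T^s` of an element, on the side `s`. -/
def part (S : Finset Plane) (s : Side) : Set Plane := hull S ∩ I.region s

end Interface

/-- Parameters of the method: the coefficient `β^±`, the weights `ω₀, …, ω₃` of the
least-squares form, and the factor `λ` of the fictitious elements. -/
structure Coeffs where
  β : Side → ℝ
  β_pos : ∀ s, 0 < β s
  ω : Fin 4 → ℝ
  ω_pos : ∀ i, 0 < ω i
  lam : ℝ
  one_le_lam : 1 ≤ lam

/-- The average `(β⁺ + β⁻) / 2`. -/
def Coeffs.avg (B : Coeffs) : ℝ := (B.β true + B.β false) / 2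

/-! ### Immersed finite element spaces -/

/-- An element of `P_p(T) × P_p(T)` (degrees are restricted later): the polynomial `w true` is
used on `T⁺`, the polynomial `w false` on `T⁻`. -/
abbrev Pair := Side → Poly

/-- The polynomial space `P_p`. -/
def IsP (p : ℕ) (q : Poly) : Prop := q.totalDegree ≤ p

open Classical in
/-- The Lagrange nodes of degree `p` of the triangle `T`. -/
def nodes (p : ℕ) (T : Finset Plane) : Finset Plane :=
  (T.piAntidiag p).image fun m => ∑ a ∈ T, ((m a : ℝ) / (p : ℝ)) • a

/-- `ψ A`, for the nodes `A` of `T`, are the Lagrange shape functions of degree `p`. -/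
def IsLagrange (p : ℕ) (T : Finset Plane) (ψ : Plane → Poly) : Prop :=
  ∀ A ∈ nodes p T, IsP p (ψ A) ∧ val (ψ A) A = 1 ∧ ∀ B ∈ nodes p T, B ≠ A → val (ψ A) B = 0

/-- The pair with entry `q` on the side `s` and `0` on the other one. -/
def single (s : Side) (q : Poly) : Pair := fun s' => if s' = s then q else 0

/-- The fictitious element `T_λ`. -/
def fictitious (lam : ℝ) (T : Finset Plane) : Set Plane :=
  (fun y => barycenter T + lam • (y - barycenter T)) '' hull T

section LeastSquares

variable (M : Mesh) (I : Interface) (B : Coeffs)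

/-- `⟦u⟧` on `Γ`. -/
def jump0 (w : Pair) (t : ℝ) : ℝ := val (w true) (I.γ t) - val (w false) (I.γ t)

/-- `⟦∂_n u⟧` on `Γ`. -/
def jump1 (w : Pair) (t : ℝ) : ℝ :=
  dir1 (I.normal t) (w true) (I.γ t) - dir1 (I.normal t) (w false) (I.γ t)

/-- `⟦β ∂_nn u⟧` on `Γ`. -/
def jump2 (w : Pair) (t : ℝ) : ℝ :=
  B.β true * dir2 (I.normal t) (I.normal t) (w true) (I.γ t) -
    B.β false * dir2 (I.normal t) (I.normal t) (w false) (I.γ t)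

/-- `∂_n Δ q + ∂_ntt q` at a point of `Γ`. -/
def shear (q : Poly) (t : ℝ) : ℝ :=
  dir1 (I.normal t) (lap q) (I.γ t) + dir3 (I.normal t) (I.tangent t) (I.tangent t) q (I.γ t)

/-- `⟦β (∂_n Δ u + ∂_ntt u)⟧` on `Γ`. -/
def jump3 (w : Pair) (t : ℝ) : ℝ :=
  B.β true * shear I (w true) t - B.β false * shear I (w false) t

/-- The least-squares form on the element `T`, which measures the violation of the interface
conditions on `T_λ ∩ Γ`. -/
def lsForm (T : Finset Plane) (w z : Pair) : ℝ :=
  B.ω 0 * I.curveInt (fictitious B.lam T) (fun t => jump0 I w t * jump0 I z t) +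
  B.ω 1 * M.meshSize ^ 2 *
    I.curveInt (fictitious B.lam T) (fun t => jump1 I w t * jump1 I z t) +
  B.ω 2 * M.meshSize ^ 4 *
    I.curveInt (fictitious B.lam T) (fun t => jump2 I B w t * jump2 I B z t) +
  B.ω 3 * M.meshSize ^ 6 *
    I.curveInt (fictitious B.lam T) (fun t => jump3 I B w t * jump3 I B z t)

/-- The local space on an interface element: combinations of the functions
`ξ_A` (the shape function of the node `A` on the side of `A`) and `η_A` (the same shape function
on the opposite side) with arbitrary nodal values `v`, where the coefficients `c` solve the linear
system that says that the function is orthogonal to all `η_A` for the least-squares form. -/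
def LocalIFE (p : ℕ) (T : Finset Plane) (w : Pair) : Prop :=
  ∃ (ψ : Plane → Poly) (v c : Plane → ℝ), IsLagrange p T ψ ∧
    w = ∑ A ∈ nodes p T, v A • single (I.side A) (ψ A) +
        ∑ A ∈ nodes p T, c A • single (!(I.side A)) (ψ A) ∧
    ∀ A ∈ nodes p T, lsForm M I B T w (single (!(I.side A)) (ψ A)) = 0

/-- The local space on a non-interface element: one polynomial of degree at most `p`. -/
def LocalStd (p : ℕ) (w : Pair) : Prop := IsP p (w true) ∧ w false = w true

/-- A piecewise polynomial function: on `T^s` it is the polynomial `u T s`. -/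
abbrev Broken := Finset Plane → Pair

/-- The global immersed finite element space `S_h^p(Ω)`. -/
structure InIFESpace (Ω : Set Plane) (p : ℕ) (u : Broken) : Prop where
  /-- `u` belongs to the local space on each element -/
  local_ife : ∀ T ∈ I.elemsI M.toTriangulation, LocalIFE M I B p T (u T)
  local_std : ∀ T ∈ M.elems, T ∉ I.elemsI M.toTriangulation → LocalStd p (u T)
  /-- `u` is continuous on the non-interface edges -/
  cont_edge : ∀ e ∈ I.intEdgesN M.toTriangulation, ∀ s, ∀ x ∈ I.part e s,
    val (u (M.first e) s) x = val (u (M.second e) s) x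
  /-- `u` is continuous at all nodes -/
  cont_node : ∀ S ∈ M.elems, ∀ T ∈ M.elems, ∀ A ∈ nodes p S, A ∈ nodes p T →
    val (u S (I.side A)) A = val (u T (I.side A)) A
  /-- `u` vanishes on the boundary of the domain -/
  boundary : ∀ T ∈ M.elems, ∀ s, ∀ x ∈ I.part T s, x ∈ frontier Ω → val (u T s) x = 0

end LeastSquares

/-! ### The bilinear form and the mesh-dependent norm -/

/-- Penalty parameters `σ_u, σ_F, σ_n`. -/
structure Penalty where
  σu : ℝ
  σF : ℝ
  σn : ℝ
  σu_pos : 0 < σu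
  σF_pos : 0 < σF
  σn_pos : 0 < σn

section Form

variable (M : Mesh) (I : Interface) (B : Coeffs) (P : Penalty)

/-- `⟦u⟧_e` on `e^s`. -/
def eJump0 (u : Broken) (e : Finset Plane) (s : Side) (x : Plane) : ℝ :=
  val (u (M.first e) s) x - val (u (M.second e) s) x

/-- `⟦∂_n u⟧_e` on `e^s`. -/
def eJump1 (u : Broken) (e : Finset Plane) (s : Side) (x : Plane) : ℝ :=
  dir1 (M.edgeNormal e) (u (M.first e) s) x - dir1 (M.edgeNormal e) (u (M.second e) s) x

/-- `⟦∂_nn u⟧_e` on `e^s`. -/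
def eJump2 (u : Broken) (e : Finset Plane) (s : Side) (x : Plane) : ℝ :=
  dir2 (M.edgeNormal e) (M.edgeNormal e) (u (M.first e) s) x -
    dir2 (M.edgeNormal e) (M.edgeNormal e) (u (M.second e) s) x

/-- The average of `β ∂_nn u` on `e^s`. -/
def eAvg2 (u : Broken) (e : Finset Plane) (s : Side) (x : Plane) : ℝ :=
  (B.β s * dir2 (M.edgeNormal e) (M.edgeNormal e) (u (M.first e) s) x +
    B.β s * dir2 (M.edgeNormal e) (M.edgeNormal e) (u (M.second e) s) x) / 2

/-- `A_h(u,v)`, the sum over `T` of the integrals over `T` of `β ∇²u : ∇²v`. -/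
def formA (u v : Broken) : ℝ :=
  ∑ T ∈ M.elems, ∑ s : Side, ∫ x in I.part T s, B.β s * hessProd (u T s) (v T s) x

/-- `J_{h,u}(u,v)`. -/
def formJu (u v : Broken) : ℝ :=
  - ∑ e ∈ M.intEdges, ∑ s : Side,
      lineInt (I.part e s) (fun x => eAvg2 M B u e s x * eJump1 M v e s x)
  - ∑ e ∈ M.intEdges, ∑ s : Side,
      lineInt (I.part e s) (fun x => eAvg2 M B v e s x * eJump1 M u e s x)
  + ∑ e ∈ I.intEdgesN M.toTriangulation, ∑ s : Side, P.σu * B.β s / length (hull e) *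
      lineInt (I.part e s) (fun x => eJump1 M u e s x * eJump1 M v e s x)
  + ∑ e ∈ I.intEdgesI M.toTriangulation, ∑ s : Side, P.σu * B.β s / length (I.part e s) *
      lineInt (I.part e s) (fun x => eJump1 M u e s x * eJump1 M v e s x)
  + ∑ T ∈ I.elemsI M.toTriangulation, P.σu * B.avg / diamT T *
      I.curveInt (hull T) (fun t => jump1 I (u T) t * jump1 I (v T) t)

/-- `J_{h,n}(u,v)`. -/
def formJn (u v : Broken) : ℝ :=
  ∑ e ∈ I.intEdgesI M.toTriangulation, ∑ s : Side, P.σF * (length (I.part e s) * B.β s *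
      lineInt (I.part e s) (fun x => eJump2 M u e s x * eJump2 M v e s x))
  + ∑ e ∈ I.intEdgesNF M.toTriangulation, ∑ s : Side, P.σF * length (hull e) * B.β s *
      lineInt (I.part e s) (fun x => eJump2 M u e s x * eJump2 M v e s x)
  + ∑ e ∈ I.intEdgesI M.toTriangulation, P.σn * B.avg / length (hull e) ^ 3 *
      ∑ s : Side, lineInt (I.part e s) (fun x => eJump0 M u e s x * eJump0 M v e s x)
  + ∑ T ∈ I.elemsI M.toTriangulation, P.σn * B.avg / diamT T ^ 3 *
      I.curveInt (hull T) (fun t => jump0 I (u T) t * jump0 I (v T) t)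

/-- The bilinear form `a_h = A_h + J_{h,u} + J_{h,n}`. -/
def form (u v : Broken) : ℝ := formA M I B u v + formJu M I B P u v + formJn M I B P u v

/-- The square of the mesh-dependent norm. -/
def normSq (v : Broken) : ℝ :=
  ∑ T ∈ M.elems, ∑ s : Side, B.β s * (∫ x in I.part T s, hessProd (v T s) (v T s) x)
  + ∑ e ∈ I.intEdgesN M.toTriangulation, ∑ s : Side, P.σu * B.β s / length (hull e) *
      lineInt (I.part e s) (fun x => eJump1 M v e s x ^ 2)
  + ∑ T ∈ I.elemsI M.toTriangulation, P.σu * B.avg / diamT T *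
      I.curveInt (hull T) (fun t => jump1 I (v T) t ^ 2)
  + ∑ e ∈ I.intEdgesI M.toTriangulation, P.σu * ∑ s : Side, B.β s / length (I.part e s) *
      lineInt (I.part e s) (fun x => eJump1 M v e s x ^ 2)
  + ∑ e ∈ I.intEdgesNF M.toTriangulation, ∑ s : Side, P.σF * length (hull e) * B.β s *
      lineInt (I.part e s) (fun x => eJump2 M v e s x ^ 2)
  + ∑ e ∈ I.intEdgesI M.toTriangulation, P.σF * ∑ s : Side, length (I.part e s) * B.β s *
      lineInt (I.part e s) (fun x => eJump2 M v e s x ^ 2)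
  + ∑ e ∈ I.intEdgesI M.toTriangulation, P.σn * B.avg / length (hull e) ^ 3 *
      ∑ s : Side, lineInt (I.part e s) (fun x => eJump0 M v e s x ^ 2)
  + ∑ T ∈ I.elemsI M.toTriangulation, P.σn * B.avg / diamT T ^ 3 *
      I.curveInt (hull T) (fun t => jump0 I (v T) t ^ 2)

/-- The mesh-dependent norm `‖v‖_h`. -/
def meshNorm (v : Broken) : ℝ := Real.sqrt (normSq M I B P v)

end Form

end

end ImmersedC0IP

open MeasureTheory Set
open scoped BigOperators

namespace ImmersedC0IP

/-! ### Polynomials of bounded degree -/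

/-! Apart from the two consistency sums, every term of `form` is a symmetric positive semidefinite
form whose diagonal is a summand of `normSq`. Cauchy–Schwarz bounds each of them with constant one
(`formA_le`, `formJn_le`, the penalties in `formJu_le`).

In a consistency term the normal jump carries the weight `σu β^s / |e^s|` of the norm, so what
remains is the trace bound `∑ |e^s| / (σu β^s) ∫_{e^s} {β ∂_nn u}² ≤ D ‖u‖_h²`
(`exists_sum_avgSq_le`). The difficulty is that `T^s` may be an arbitrarily thin sliver, on which no
uniform trace inequality holds. But the average equals either one-sided derivative plus or minus
half the jump, and the jump of `∂_nn` is penalized on all interior edges of interface elements.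
Hence one good neighbor for each edge and side suffices.

Good means that `T^s` contains a disc of radius comparable to `|e^s|` (`exists_ball_subset_part`).
By (H2) the interface crosses an open edge at most once, so `e^s` contains an interval of comparable
size; let `m` be its midpoint. By (H3) the discs of radius at most `r` tangent to `Γ` avoid `Γ`
(`TubularRadius.disjoint_ball`), so a disc of radius proportional to `ρ |e^s|` with `m` on its
boundary fits into the side of `m` (`TubularRadius.exists_ball_subset`). Its center is on the side
of one of the two neighbors, and shape regularity puts a disc of half the radius inside that
triangle.

From such a disc the polynomial on `T^s`, of degree at most `p`, is controlled on all of `e^s` by an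
inverse estimate whose constant depends only on `p` and the ratio of sizes. Neither the position of
the cut nor `β` enters, since each side is treated with its own `β^s`. Edges that belong to no
interface element carry no bending penalty, but there both neighbors are uncut and the ordinary
trace inequality applies. -/

theorem continuous_val (q : Poly) : Continuous (val q) := by
  unfold val
  exact (MvPolynomial.continuous_eval q).comp (by fun_prop)

@[simp] theorem val_add (q w : Poly) (x : Plane) : val (q + w) x = val q x + val w x := by
  simp [val]

@[simp] theorem val_smul (c : ℝ) (q : Poly) (x : Plane) : val (c • q) x = c * val q x := by
  simp [val, MvPolynomial.smul_eval]

theorem val_sum {ι : Type*} (s : Finset ι) (f : ι → Poly) (x : Plane) :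
    val (∑ i ∈ s, f i) x = ∑ i ∈ s, val (f i) x := by
  simp [val]

/-- The crude bound `p` instead of `p - 1` is enough: second derivatives only have to stay in one
fixed finite-dimensional space. -/
theorem IsP.pderiv {p : ℕ} {q : Poly} (hq : IsP p q) (i : Fin 2) :
    IsP p (MvPolynomial.pderiv i q) := by
  unfold IsP at *
  conv_lhs => rw [q.as_sum, map_sum]
  refine MvPolynomial.totalDegree_finsetSum_le fun d hd => ?_
  rw [MvPolynomial.pderiv_monomial]
  refine (MvPolynomial.totalDegree_monomial_le _ _).trans (le_trans ?_ hq)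
  refine le_trans ?_ (MvPolynomial.le_totalDegree hd)
  change Finsupp.degree _ ≤ Finsupp.degree _
  exact Finsupp.degree_mono tsub_le_self

theorem isP_sum {ι : Type*} {p : ℕ} (s : Finset ι) (f : ι → Poly) (h : ∀ i ∈ s, IsP p (f i)) :
    IsP p (∑ i ∈ s, f i) :=
  MvPolynomial.totalDegree_finsetSum_le h

theorem IsP.smul {p : ℕ} {q : Poly} (hq : IsP p q) (c : ℝ) : IsP p (c • q) :=
  (MvPolynomial.totalDegree_smul_le c q).trans hq

/-- Substitution of `z + ϱ x` for `x`. -/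
noncomputable def affineSubst (z : Plane) (R : ℝ) (q : Poly) : Poly :=
  MvPolynomial.bind₁ (fun i => MvPolynomial.C (z i) + MvPolynomial.C R * MvPolynomial.X i) q

theorem val_affineSubst (z : Plane) (R : ℝ) (q : Poly) (x : Plane) :
    val (affineSubst z R q) x = val q (z + R • x) := by
  unfold val affineSubst
  rw [← MvPolynomial.coe_aeval_eq_eval, ← MvPolynomial.coe_aeval_eq_eval]
  simp only [RingHom.coe_coe]
  rw [MvPolynomial.aeval_bind₁]
  congr 2
  ext i
  simp

theorem IsP.affineSubst {p : ℕ} {q : Poly} (hq : IsP p q) (z : Plane) (R : ℝ) :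
    IsP p (affineSubst z R q) := by
  unfold IsP ImmersedC0IP.affineSubst at *
  rw [MvPolynomial.bind₁, MvPolynomial.aeval_def, MvPolynomial.eval₂_eq']
  refine MvPolynomial.totalDegree_finsetSum_le fun d hd => ?_
  refine le_trans (MvPolynomial.totalDegree_mul _ _) ?_
  have h1 : (MvPolynomial.totalDegree
      ((algebraMap ℝ (MvPolynomial (Fin 2) ℝ)) (MvPolynomial.coeff d q))) = 0 :=
    MvPolynomial.totalDegree_C _
  rw [h1, zero_add]
  refine le_trans (MvPolynomial.totalDegree_finsetProd _ _) ?_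
  refine le_trans ?_ (le_trans (MvPolynomial.le_totalDegree hd) hq)
  rw [Finsupp.sum_fintype _ _ (fun _ => rfl)]
  refine Finset.sum_le_sum fun i _ => ?_
  refine le_trans (MvPolynomial.totalDegree_pow _ _) ?_
  refine (Nat.mul_le_mul_left _ ?_).trans (mul_one _).le
  refine le_trans (MvPolynomial.totalDegree_add _ _) ?_
  refine max_le (by simp) (le_trans (MvPolynomial.totalDegree_mul _ _) ?_)
  simp

/-! ### Inverse estimates on discs -/

theorem eq_zero_of_val_eq_zero_on_ball {q : Poly} {z : Plane} {R : ℝ} (hR : 0 < R)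
    (h : ∀ x ∈ Metric.ball z R, val q x = 0) : q = 0 := by
  have hop : IsOpen ((WithLp.toLp 2 : (Fin 2 → ℝ) → Plane) ⁻¹' Metric.ball z R) :=
    Metric.isOpen_ball.preimage (by fun_prop)
  have hz : (fun i => z i) ∈ ((WithLp.toLp 2 : (Fin 2 → ℝ) → Plane) ⁻¹' Metric.ball z R) := by
    simpa using hR
  -- In the sup metric a ball is a product of intervals, and a polynomial that vanishes on a product
  -- of infinite sets is zero.
  obtain ⟨ε, hε, hsub⟩ := Metric.isOpen_iff.1 hop _ hz
  refine MvPolynomial.funext_set (fun i => Metric.ball (z i) ε) (fun i => ?_) fun x hx => ?_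
  · rw [Real.ball_eq_Ioo]
    exact Set.Ioo_infinite (by linarith)
  · have := hsub (show x ∈ Metric.ball (fun i => z i) ε by
      rw [ball_pi _ hε]; exact hx)
    simpa [val] using h _ this

theorem integrableOn_ball_val_sq (q : Poly) (z : Plane) (R : ℝ) :
    IntegrableOn (fun x => val q x ^ 2) (Metric.ball z R) :=
  (((continuous_val q).pow 2).continuousOn.integrableOn_compact
    (isCompact_closedBall z R)).mono_set Metric.ball_subset_closedBall

/-- Inverse estimate on the unit ball. -/
theorem exists_sq_le_integral_unitBall (p : ℕ) (K : ℝ) :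
    ∃ C : ℝ, 0 < C ∧ ∀ q : Poly, IsP p q → ∀ x ∈ Metric.closedBall (0 : Plane) K,
      val q x ^ 2 ≤ C * ∫ y in Metric.ball (0 : Plane) 1, val q y ^ 2 := by
  let V := MvPolynomial.restrictTotalDegree (Fin 2) ℝ p
  let b := Module.finBasis ℝ V
  let d := Module.finrank ℝ V
  let f : (Fin d → ℝ) → Poly := fun c => ((∑ i, c i • b i : V) : Poly)
  have hf : ∀ c x, val (f c) x = ∑ i, c i * val (b i : Poly) x := by
    intro c x
    simp only [f, Submodule.coe_sum, Submodule.coe_smul, val_sum, val_smul]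
  -- In coordinates the mean square is a positive definite quadratic form. Its minimum `μ` on the
  -- unit sphere bounds the coefficients, and these bound the point values.
  let F : (Fin d → ℝ) → ℝ := fun c => ∫ y in Metric.ball (0 : Plane) 1, val (f c) y ^ 2
  have hF : Continuous F := by
    have hF' : F = fun c => ∑ i, ∑ j, c i * c j *
        ∫ y in Metric.ball (0 : Plane) 1, val (b i : Poly) y * val (b j : Poly) y := by
      funext c
      simp only [F, hf, pow_two, Finset.sum_mul_sum]
      have hint : ∀ i j, Integrable (fun y => c i * val (b i : Poly) y * (c j * val (b j : Poly) y))
          (volume.restrict (Metric.ball (0 : Plane) 1)) := fun i j =>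
        (ContinuousOn.integrableOn_compact (isCompact_closedBall (0 : Plane) 1)
          (((continuous_const.mul (continuous_val _)).mul
            (continuous_const.mul (continuous_val _))).continuousOn)).mono_set
            Metric.ball_subset_closedBall
      rw [integral_finsetSum _ fun i _ => integrable_finsetSum _ fun j _ => hint i j]
      refine Finset.sum_congr rfl fun i _ => ?_
      rw [integral_finsetSum _ fun j _ => hint i j]
      refine Finset.sum_congr rfl fun j _ => ?_
      rw [← integral_const_mul]
      exact integral_congr_ae (Filter.Eventually.of_forall fun y => by ring)
    rw [hF']
    fun_prop
  have hpos : ∀ c, c ≠ 0 → 0 < F c := by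
    intro c hc
    have h0 : 0 ≤ F c := integral_nonneg fun y => sq_nonneg _
    refine lt_of_le_of_ne h0 fun h => hc ?_
    have h1 := (setIntegral_eq_zero_iff_of_nonneg_ae
      (Filter.Eventually.of_forall fun y => sq_nonneg _)
      (integrableOn_ball_val_sq (f c) 0 1)).1 h.symm
    have h2 : EqOn (fun y => val (f c) y ^ 2) 0 (Metric.ball (0 : Plane) 1) :=
      Measure.eqOn_open_of_ae_eq h1 Metric.isOpen_ball
        ((continuous_val _).pow 2).continuousOn continuousOn_const
    have h3 : f c = 0 := eq_zero_of_val_eq_zero_on_ball one_pos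
      fun x hx => pow_eq_zero_iff two_ne_zero |>.1 (h2 hx)
    have h4 : (∑ i, c i • b i : V) = 0 := Subtype.ext h3
    funext i
    exact (Fintype.linearIndependent_iff.1 b.linearIndependent) c h4 i
  have hμ : ∃ μ > 0, ∀ c : Fin d → ℝ, μ * ‖c‖ ^ 2 ≤ F c := by
    by_cases hne : (Metric.sphere (0 : Fin d → ℝ) 1).Nonempty
    · obtain ⟨c0, hc0, hmin⟩ := (isCompact_sphere (0 : Fin d → ℝ) 1).exists_isMinOn hne
        hF.continuousOn
      refine ⟨F c0, hpos _ (by rintro rfl; simp at hc0), fun c => ?_⟩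
      by_cases hc : c = 0
      · subst hc
        simpa using integral_nonneg fun y => sq_nonneg _
      · have hn : ‖c‖ ≠ 0 := norm_ne_zero_iff.2 hc
        have hmem : ‖c‖⁻¹ • c ∈ Metric.sphere (0 : Fin d → ℝ) 1 := by
          simp [norm_smul, hn]
        have h1 := hmin hmem
        have h2 : F c = ‖c‖ ^ 2 * F (‖c‖⁻¹ • c) := by
          simp only [F]
          rw [← integral_const_mul]
          refine integral_congr_ae (Filter.Eventually.of_forall fun y => ?_)
          simp only [hf, Pi.smul_apply, smul_eq_mul, mul_assoc, ← Finset.mul_sum]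
          field_simp
        rw [h2, mul_comm]
        exact mul_le_mul_of_nonneg_left h1 (sq_nonneg _)
    -- If the sphere is empty, the only coefficient vector is zero and any `μ` works.
    · refine ⟨1, one_pos, fun c => ?_⟩
      by_cases hc : c = 0
      · subst hc
        simpa using integral_nonneg fun y => sq_nonneg _
      · have hn : ‖c‖ ≠ 0 := norm_ne_zero_iff.2 hc
        exact absurd ⟨‖c‖⁻¹ • c, by simp [norm_smul, hn]⟩ hne
  obtain ⟨μ, hμ0, hμ⟩ := hμ
  have hB : ∃ B : ℝ, 0 < B ∧ ∀ x ∈ Metric.closedBall (0 : Plane) K,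
      ∑ i, |val (b i : Poly) x| ≤ B := by
    obtain ⟨B, hB⟩ := (isCompact_closedBall (0 : Plane) K).exists_bound_of_continuousOn
      (f := fun x => ∑ i, |val (b i : Poly) x|)
      (continuous_finsetSum _ fun i _ => (continuous_val _).abs).continuousOn
    exact ⟨max B 1, by positivity, fun x hx =>
      (le_abs_self _).trans ((hB x hx).trans (le_max_left _ _))⟩
  obtain ⟨B, hB0, hB⟩ := hB
  refine ⟨B ^ 2 / μ, by positivity, fun q hq x hx => ?_⟩
  have hqV : q ∈ V := (MvPolynomial.mem_restrictTotalDegree _ _ _).2 hq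
  obtain ⟨c, hc⟩ : ∃ c, f c = q :=
    ⟨fun i => b.repr ⟨q, hqV⟩ i, congrArg Subtype.val (b.sum_repr ⟨q, hqV⟩)⟩
  subst hc
  have h1 : |val (f c) x| ≤ ‖c‖ * B := by
    rw [hf]
    refine (Finset.abs_sum_le_sum_abs _ _).trans ?_
    refine le_trans ?_ (mul_le_mul_of_nonneg_left (hB x hx) (norm_nonneg c))
    rw [Finset.mul_sum]
    refine Finset.sum_le_sum fun i _ => ?_
    rw [abs_mul]
    exact mul_le_mul_of_nonneg_right (norm_le_pi_norm c i) (abs_nonneg _)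
  have h2 : val (f c) x ^ 2 ≤ (‖c‖ * B) ^ 2 := by
    rw [← sq_abs]
    exact pow_le_pow_left₀ (abs_nonneg _) h1 2
  have h3 := hμ c
  calc val (f c) x ^ 2 ≤ (‖c‖ * B) ^ 2 := h2
    _ = B ^ 2 / μ * (μ * ‖c‖ ^ 2) := by field_simp
    _ ≤ _ := mul_le_mul_of_nonneg_left h3 (by positivity)

open scoped Pointwise in
theorem setIntegral_ball_eq (f : Plane → ℝ) (z : Plane) {R : ℝ} (hR : 0 < R) :
    ∫ y in Metric.ball z R, f y = R ^ 2 * ∫ y in Metric.ball (0 : Plane) 1, f (z + R • y) := by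
  have h1 := Measure.setIntegral_comp_smul_of_pos (volume : Measure Plane)
    (fun y => f (z + y)) (Metric.ball (0 : Plane) 1) hR
  have h2 : R • Metric.ball (0 : Plane) 1 = Metric.ball 0 R := by
    rw [smul_unitBall_of_pos hR]
  rw [h2] at h1
  simp only [finrank_euclideanSpace, Fintype.card_fin, smul_eq_mul] at h1
  rw [h1]
  have h3 : ∫ y in Metric.ball (0 : Plane) R, f (z + y) = ∫ y in Metric.ball z R, f y := by
    have := (measurePreserving_add_left (volume : Measure Plane) z).setIntegral_preimage_emb
      (measurableEmbedding_addLeft z) f (Metric.ball z R)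
    rw [← this]
    congr 2
    ext y
    simp [dist_eq_norm]
  rw [h3]
  field_simp

/-- Inverse estimate: point values of a polynomial near a ball are controlled by the mean square
over the ball. -/
theorem exists_sq_le_integral_ball (p : ℕ) (K : ℝ) :
    ∃ C : ℝ, 0 < C ∧ ∀ q : Poly, IsP p q → ∀ (z : Plane) (R : ℝ), 0 < R →
      ∀ x ∈ Metric.closedBall z (K * R),
      R ^ 2 * val q x ^ 2 ≤ C * ∫ y in Metric.ball z R, val q y ^ 2 := by
  obtain ⟨C, hC, h⟩ := exists_sq_le_integral_unitBall p K
  refine ⟨C, hC, fun q hq z R hR x hx => ?_⟩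
  -- Rescale to the unit disc; the factor `R ^ 2` in the claim is the Jacobian of this dilation in
  -- the plane.
  have h1 := h _ (hq.affineSubst z R) (R⁻¹ • (x - z)) (by
    rw [mem_closedBall_zero_iff, norm_smul, norm_inv, Real.norm_of_nonneg hR.le]
    rw [Metric.mem_closedBall, dist_eq_norm] at hx
    rw [inv_mul_le_iff₀ hR, mul_comm]
    exact hx)
  simp only [val_affineSubst] at h1
  rw [smul_inv_smul₀ hR.ne', add_sub_cancel] at h1
  rw [setIntegral_ball_eq _ z hR]
  calc R ^ 2 * val q x ^ 2 ≤ R ^ 2 * _ := mul_le_mul_of_nonneg_left h1 (sq_nonneg R)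
    _ = _ := by ring

theorem hessProd_self_nonneg (q : Poly) (x : Plane) : 0 ≤ hessProd q q x :=
  Finset.sum_nonneg fun _ _ => Finset.sum_nonneg fun _ _ => mul_self_nonneg _

theorem continuous_hessProd (q w : Poly) : Continuous (hessProd q w) := by
  unfold hessProd
  exact continuous_finsetSum _ fun i _ => continuous_finsetSum _ fun j _ =>
    (continuous_val _).mul (continuous_val _)

theorem continuous_dir1 (a : Plane) (q : Poly) : Continuous (dir1 a q) := by
  unfold dir1
  exact continuous_finsetSum _ fun i _ => continuous_const.mul (continuous_val _)

theorem continuous_dir2 (a b : Plane) (q : Poly) : Continuous (dir2 a b q) := by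
  unfold dir2
  exact continuous_finsetSum _ fun i _ => continuous_finsetSum _ fun j _ =>
    continuous_const.mul (continuous_val _)

/-- Cauchy–Schwarz for the Frobenius product of the Hessian with `a ⊗ a`, whose Frobenius norm is
`‖a‖² ≤ 1`. -/
theorem dir2_sq_le_hessProd {a : Plane} (ha : ‖a‖ ≤ 1) (q : Poly) (x : Plane) :
    dir2 a a q x ^ 2 ≤ hessProd q q x := by
  have h1 : (a 0) ^ 2 + (a 1) ^ 2 ≤ 1 := by
    have := EuclideanSpace.real_norm_sq_eq a
    rw [Fin.sum_univ_two] at this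
    rw [← this]
    exact pow_le_one₀ (norm_nonneg _) ha
  simp only [dir2, hessProd, ← Finset.sum_product']
  have h2 := Finset.sum_mul_sq_le_sq_mul_sq (Finset.univ ×ˢ Finset.univ : Finset (Fin 2 × Fin 2))
    (fun k => a k.1 * a k.2)
    (fun k => val (MvPolynomial.pderiv k.1 (MvPolynomial.pderiv k.2 q)) x)
  refine h2.trans ?_
  simp only [← pow_two]
  refine mul_le_of_le_one_left (Finset.sum_nonneg fun _ _ => sq_nonneg _) ?_
  simp only [Finset.sum_product, Fin.sum_univ_two]
  nlinarith [sq_nonneg (a 0), sq_nonneg (a 1)]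

/-- The inverse estimate is applied to each second partial derivative separately. This makes the
constant independent of the direction `a`. -/
theorem exists_dir2_sq_le_integral_ball (p : ℕ) (K : ℝ) :
    ∃ C : ℝ, 0 < C ∧ ∀ q : Poly, IsP p q → ∀ (a z : Plane) (R : ℝ), ‖a‖ ≤ 1 → 0 < R →
      ∀ x ∈ Metric.closedBall z (K * R),
      R ^ 2 * dir2 a a q x ^ 2 ≤ C * ∫ y in Metric.ball z R, hessProd q q y := by
  obtain ⟨C, hC, h⟩ := exists_sq_le_integral_ball p K
  refine ⟨C, hC, fun q hq a z R ha hR x hx => ?_⟩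
  have hint : ∀ i j, Integrable (fun y =>
      val (MvPolynomial.pderiv i (MvPolynomial.pderiv j q)) y *
      val (MvPolynomial.pderiv i (MvPolynomial.pderiv j q)) y)
      (volume.restrict (Metric.ball z R)) := fun i j => by
    have := integrableOn_ball_val_sq
      (MvPolynomial.pderiv i (MvPolynomial.pderiv j q)) z R
    simp only [pow_two] at this
    exact this
  refine (mul_le_mul_of_nonneg_left (dir2_sq_le_hessProd ha q x) (sq_nonneg R)).trans ?_
  simp only [hessProd]
  rw [integral_finsetSum _ fun i _ => integrable_finsetSum _ fun j _ => hint i j]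
  simp only [Finset.mul_sum]
  refine Finset.sum_le_sum fun i _ => ?_
  rw [integral_finsetSum _ fun j _ => hint i j, Finset.mul_sum]
  refine Finset.sum_le_sum fun j _ => ?_
  simpa only [pow_two] using h _ ((hq.pderiv j).pderiv i) z R hR x hx

/-! ### Geometry of the interface -/

namespace Interface

variable (I : Interface)

theorem continuous_γ : Continuous I.γ := I.smooth.continuous

theorem continuous_deriv_γ : Continuous (deriv I.γ) := I.smooth.continuous_deriv (by norm_num)

theorem curve_eq_image : I.curve = I.γ '' Icc 0 I.period := by
  refine Subset.antisymm ?_ (image_subset_range _ _)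
  rintro _ ⟨t, rfl⟩
  obtain ⟨t', ht', h⟩ := I.periodic.exists_mem_Ico₀ I.period_pos t
  exact ⟨t', Ico_subset_Icc_self ht', h.symm⟩

theorem isCompact_curve : IsCompact I.curve := by
  rw [curve_eq_image]
  exact isCompact_Icc.image I.continuous_γ

theorem curve_nonempty : I.curve.Nonempty := range_nonempty _

theorem exists_param {x : Plane} (hx : x ∈ I.curve) : ∃ t ∈ Ico 0 I.period, I.γ t = x := by
  obtain ⟨t, rfl⟩ := hx
  obtain ⟨t', ht', h⟩ := I.periodic.exists_mem_Ico₀ I.period_pos t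
  exact ⟨t', ht', h.symm⟩

theorem norm_tangent (t : ℝ) : ‖I.tangent t‖ = 1 := by
  unfold tangent
  rw [norm_smul, norm_inv, norm_norm, inv_mul_cancel₀ (norm_ne_zero_iff.2 (I.regular t))]

theorem tangent_sq (t : ℝ) : I.tangent t 0 ^ 2 + I.tangent t 1 ^ 2 = 1 := by
  have h := EuclideanSpace.real_norm_sq_eq (I.tangent t)
  rw [Fin.sum_univ_two, norm_tangent] at h
  linarith

theorem norm_normal (t : ℝ) : ‖I.normal t‖ = 1 := by
  have h := EuclideanSpace.real_norm_sq_eq (I.normal t)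
  rw [Fin.sum_univ_two] at h
  simp only [normal, PiLp.toLp_apply, Matrix.cons_val_zero, Matrix.cons_val_one] at h
  have h2 := I.tangent_sq t
  have h3 : ‖I.normal t‖ ^ 2 = 1 := by
    unfold normal
    rw [h]
    linarith
  exact (pow_eq_one_iff_of_nonneg (norm_nonneg _) two_ne_zero).1 h3

/-- A point is on the normal line through its nearest point of the curve. -/
theorem exists_eq_add_smul_normal {c : Plane} {t : ℝ}
    (h : ∀ y ∈ I.curve, dist c (I.γ t) ≤ dist c y) :
    ∃ a : ℝ, |a| = dist c (I.γ t) ∧ c = I.γ t + a • I.normal t := by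
  have hd : HasDerivAt I.γ (deriv I.γ t) t :=
    (I.smooth.differentiable (by norm_num) t).hasDerivAt
  have h1 : HasDerivAt (fun u => ‖I.γ u - c‖ ^ 2)
      (2 * inner ℝ (I.γ t - c) (deriv I.γ t)) t := (hd.sub_const c).norm_sq
  -- Minimality among all points of the curve gives the first-order condition that `γ t - c` is
  -- orthogonal to the tangent.
  have hmin : IsLocalMin (fun u => ‖I.γ u - c‖ ^ 2) t := by
    refine Filter.Eventually.of_forall fun u => ?_
    have := h (I.γ u) (mem_range_self u)
    rw [dist_comm, dist_comm c, dist_eq_norm, dist_eq_norm] at this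
    exact pow_le_pow_left₀ (norm_nonneg _) this 2
  have h2 : inner ℝ (I.γ t - c) (deriv I.γ t) = 0 := by
    have := hmin.hasDerivAt_eq_zero h1
    linarith
  have h3 : inner ℝ (I.γ t - c) (I.tangent t) = 0 := by
    unfold tangent
    rw [inner_smul_right, h2, mul_zero]
  rw [PiLp.inner_apply, Fin.sum_univ_two] at h3
  simp only [RCLike.inner_apply, conj_trivial, PiLp.sub_apply] at h3
  have h4 := I.tangent_sq t
  obtain ⟨a, ha⟩ : ∃ a : ℝ, c = I.γ t + a • I.normal t := by
    -- The coefficient is the inner product of `c - γ t` with the unit normal; the tangential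
    -- component has just been shown to vanish.
    refine ⟨-(c 0 - I.γ t 0) * I.tangent t 1 + (c 1 - I.γ t 1) * I.tangent t 0, ?_⟩
    ext i
    fin_cases i
    · simp [normal]
      linear_combination (c 0 - I.γ t 0) * (-h4) - I.tangent t 0 * h3
    · simp [normal]
      linear_combination (c 1 - I.γ t 1) * (-h4) - I.tangent t 1 * h3
  refine ⟨a, ?_, ha⟩
  nth_rewrite 1 [ha]
  rw [dist_eq_norm, add_sub_cancel_left, norm_smul, norm_normal, mul_one, Real.norm_eq_abs]

theorem add_smul_mem_normalSegment {r a : ℝ} (hr : 0 < r) (t : ℝ) (ha : |a| ≤ r) :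
    I.γ t + a • I.normal t ∈ I.normalSegment r t := by
  obtain ⟨h1, h2⟩ := abs_le.1 ha
  refine ⟨(r - a) / (2 * r), (r + a) / (2 * r), by apply div_nonneg <;> linarith,
    by apply div_nonneg <;> linarith, by field_simp; ring, ?_⟩
  have e1 : (r - a) / (2 * r) = 1 - (r + a) / (2 * r) := by field_simp; ring
  have e2 : a = (r + a) / (2 * r) * r - (1 - (r + a) / (2 * r)) * r := by field_simp; ring
  rw [e1]
  nth_rewrite 3 [e2]
  module

/-- The open discs of radius `r` that are tangent to the curve do not meet the curve. -/
theorem TubularRadius.disjoint_ball {I : Interface} {r : ℝ} (h : I.TubularRadius r) {t a : ℝ}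
    (ht : t ∈ Ico 0 I.period) (ha : |a| ≤ r) :
    Disjoint (Metric.ball (I.γ t + a • I.normal t) |a|) I.curve := by
  rw [disjoint_left]
  intro y hy hyc
  -- If the curve entered the disc, the point nearest to the center would be at distance less than
  -- `|a| ≤ r`. The center would then lie on the normal segments of two different points, or on that
  -- of `γ t` alone but at a distance other than `|a|`.
  obtain ⟨x, hx, hmin⟩ := I.isCompact_curve.exists_infDist_eq_dist I.curve_nonempty
    (I.γ t + a • I.normal t)
  obtain ⟨t', ht', rfl⟩ := I.exists_param hx
  have hle : ∀ y ∈ I.curve, dist (I.γ t + a • I.normal t) (I.γ t') ≤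
      dist (I.γ t + a • I.normal t) y := fun y hy => by
    rw [← hmin]
    exact Metric.infDist_le_dist_of_mem hy
  obtain ⟨b, hb, hc⟩ := I.exists_eq_add_smul_normal hle
  have hlt : |b| < |a| := by
    rw [hb]
    refine (hle y hyc).trans_lt ?_
    rw [dist_comm]
    exact hy
  by_cases htt : t = t'
  · subst htt
    have : dist (I.γ t + a • I.normal t) (I.γ t) = |a| := by
      rw [dist_eq_norm, add_sub_cancel_left, norm_smul, norm_normal, mul_one, Real.norm_eq_abs]
    linarith
  · refine disjoint_left.1 (h.2 t ht t' ht' htt) (I.add_smul_mem_normalSegment h.1 t ha) ?_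
    rw [hc]
    exact I.add_smul_mem_normalSegment h.1 t' (hlt.le.trans ha)

theorem region_true_or_false {x : Plane} (hx : x ∉ I.curve) :
    x ∈ I.region true ∨ x ∈ I.region false := by
  have : x ∈ I.region true ∪ I.region false := by
    rw [I.region_cover]
    exact hx
  exact this

theorem not_mem_curve {s : Side} {x : Plane} (hx : x ∈ I.region s) : x ∉ I.curve := by
  have : x ∈ (range I.γ)ᶜ := by
    rw [← I.region_cover]
    cases s
    · exact Or.inr hx
    · exact Or.inl hx
  exact this

theorem region_disjoint_not (s : Side) : Disjoint (I.region s) (I.region (!s)) := by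
  cases s
  · exact I.region_disjoint.symm
  · exact I.region_disjoint

/-- A connected set that does not meet the curve lies on one side. -/
theorem subset_region {S : Set Plane} (hS : IsPreconnected S) (hd : Disjoint S I.curve) {s : Side}
    {x : Plane} (hxS : x ∈ S) (hx : x ∈ I.region s) : S ⊆ I.region s := by
  refine hS.subset_left_of_subset_union (I.region_open s) (I.region_open !s)
    (I.region_disjoint_not s) (fun y hy => ?_) ⟨x, hxS, hx⟩
  have := I.region_true_or_false (disjoint_left.1 hd hy)
  cases s
  · exact this.symm
  · exact this

/-- Every point of a side of the interface is on the boundary of a disc of given small radius that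
is contained in this side. -/
theorem TubularRadius.exists_ball_subset {I : Interface} {r : ℝ} (h : I.TubularRadius r)
    {s : Side} {m : Plane} (hm : m ∈ I.region s) {τ : ℝ} (hτ : 0 < τ) (hτr : τ ≤ r / 4) :
    ∃ ν : Plane, ‖ν‖ = 1 ∧ Metric.ball (m + τ • ν) τ ⊆ I.region s := by
  obtain ⟨x, hx, hmin⟩ := I.isCompact_curve.exists_infDist_eq_dist I.curve_nonempty m
  obtain ⟨t, ht, rfl⟩ := I.exists_param hx
  have hle : ∀ y ∈ I.curve, dist m (I.γ t) ≤ dist m y := fun y hy => by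
    rw [← hmin]
    exact Metric.infDist_le_dist_of_mem hy
  obtain ⟨b, hb, hc⟩ := I.exists_eq_add_smul_normal hle
  have hb0 : 0 < |b| := by
    rw [hb]
    refine dist_pos.2 fun hmx => I.not_mem_curve hm ?_
    rw [hmx]
    exact hx
  -- Far from the curve the disc of radius `2 * τ` around `m` is free of it, and any direction can
  -- serve as `ν`.
  by_cases hbτ : 2 * τ ≤ |b|
  · refine ⟨I.normal t, I.norm_normal t, ?_⟩
    have h1 : Metric.ball m (2 * τ) ⊆ I.region s := by
      refine I.subset_region (convex_ball m _).isPreconnected ?_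
        (Metric.mem_ball_self (by linarith)) hm
      rw [disjoint_left]
      intro y hy hyc
      have h2 := hle y hyc
      rw [Metric.mem_ball, dist_comm] at hy
      linarith
    refine Subset.trans (Metric.ball_subset_ball' ?_) h1
    rw [dist_eq_norm, add_sub_cancel_left, norm_smul, norm_normal, Real.norm_of_nonneg hτ.le]
    linarith
  · push Not at hbτ
    -- Near the curve, `m` lies in the disc of radius `r` that is tangent at the nearest point and
    -- on the side of `m`. Moving away from the curve by `τ` stays within distance `r - τ` of its
    -- center, because `|b| + 2 * τ < 4 * τ ≤ r`.
    set a : ℝ := SignType.sign b * r with ha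
    have hsb : |((SignType.sign b : SignType) : ℝ)| = 1 := by
      rcases lt_or_gt_of_ne (abs_pos.1 hb0) with hlt | hgt
      · simp [sign_neg hlt]
      · simp [sign_pos hgt]
    have haa : |a| = r := by rw [ha, abs_mul, hsb, one_mul, abs_of_pos h.1]
    have hbs : b = SignType.sign b * |b| := (sign_mul_abs b).symm
    have hdis := h.disjoint_ball ht haa.le
    rw [haa] at hdis
    refine ⟨(SignType.sign b : ℝ) • I.normal t, ?_, ?_⟩
    · rw [norm_smul, norm_normal, mul_one, Real.norm_eq_abs, hsb]
    have hsub := I.subset_region (convex_ball (I.γ t + a • I.normal t) r).isPreconnected hdis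
      (x := m) (s := s) (by
        rw [Metric.mem_ball, hc, dist_eq_norm]
        have : I.γ t + b • I.normal t - (I.γ t + a • I.normal t) =
            ((SignType.sign b : ℝ) * (|b| - r)) • I.normal t := by
          rw [ha]; nth_rewrite 1 [hbs]; module
        rw [this, norm_smul, norm_normal, mul_one, Real.norm_eq_abs, abs_mul, hsb, one_mul,
          abs_lt]
        constructor <;> linarith) hm
    refine Subset.trans (Metric.ball_subset_ball' ?_) hsub
    rw [hc, dist_eq_norm]
    have : I.γ t + b • I.normal t + τ • (SignType.sign b : ℝ) • I.normal t -
        (I.γ t + a • I.normal t) = ((SignType.sign b : ℝ) * (|b| + τ - r)) • I.normal t := by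
      rw [ha]; nth_rewrite 1 [hbs]; module
    rw [this, norm_smul, norm_normal, mul_one, Real.norm_eq_abs, abs_mul, hsb, one_mul]
    have : |(|b| + τ - r)| ≤ r - τ := abs_le.2 ⟨by linarith, by linarith⟩
    linarith

end Interface

/-! ### Geometry of triangles -/

/-- `lam A`, for `A ∈ T`, are the barycentric coordinates of the triangle `T`. -/
structure IsBary (T : Finset Plane) (lam : Plane → (Plane →ᵃ[ℝ] ℝ)) : Prop where
  self : ∀ A ∈ T, lam A A = 1
  ne : ∀ A ∈ T, ∀ B ∈ T, B ≠ A → lam A B = 0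
  mem_hull : ∀ x, x ∈ hull T ↔ ∀ A ∈ T, 0 ≤ lam A x
  mem_interior : ∀ x, x ∈ interior (hull T) ↔ ∀ A ∈ T, 0 < lam A x
  sum_eq : ∀ x, ∑ A ∈ T, lam A x = 1

theorem Triangulation.exists_isBary (M : Triangulation) {T : Finset Plane} (hT : T ∈ M.elems) :
    ∃ lam, IsBary T lam := by
  classical
  have hspan : affineSpan ℝ (range (Subtype.val : T → Plane)) = ⊤ := by
    rw [(M.indep T hT).affineSpan_eq_top_iff_card_eq_finrank_add_one]
    simp [M.card_eq T hT]
  let b : AffineBasis T ℝ Plane := ⟨Subtype.val, M.indep T hT, hspan⟩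
  have hr : range b = (T : Set Plane) := by
    change range (Subtype.val : T → Plane) = _
    exact Subtype.range_coe
  -- Indexing by all points of the plane, with value `0` off the vertices, avoids subtypes later.
  let lam : Plane → (Plane →ᵃ[ℝ] ℝ) := fun A => if h : A ∈ T then b.coord ⟨A, h⟩ else 0
  have hlam : ∀ i : T, lam i.1 = b.coord i := fun i => by simp [lam]
  refine ⟨lam, ⟨fun A hA => ?_, fun A hA B hB hAB => ?_, fun x => ?_, fun x => ?_, fun x => ?_⟩⟩
  · rw [hlam ⟨A, hA⟩]
    exact b.coord_apply_eq ⟨A, hA⟩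
  · rw [hlam ⟨A, hA⟩]
    exact b.coord_apply_ne (i := ⟨A, hA⟩) (j := ⟨B, hB⟩)
      fun h => hAB (congrArg Subtype.val h).symm
  · have := b.convexHull_eq_nonneg_coord
    unfold hull
    rw [← hr, this]
    exact ⟨fun h A hA => by rw [hlam ⟨A, hA⟩]; exact h _,
      fun h i => by rw [← hlam i]; exact h _ i.2⟩
  · have := b.interior_convexHull
    unfold hull
    rw [← hr, this]
    exact ⟨fun h A hA => by rw [hlam ⟨A, hA⟩]; exact h _,
      fun h i => by rw [← hlam i]; exact h _ i.2⟩
  · rw [← Finset.sum_coe_sort]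
    simp only [hlam]
    exact b.sum_coord_apply_eq_one x

namespace IsBary

variable {T : Finset Plane} {lam : Plane → (Plane →ᵃ[ℝ] ℝ)}

theorem le_one (h : IsBary T lam) {x A : Plane} (hA : A ∈ T) (hx : x ∈ hull T) : lam A x ≤ 1 := by
  rw [← h.sum_eq x]
  exact Finset.single_le_sum (f := fun A => lam A x) ((h.mem_hull x).1 hx) hA

/-- Barycentric coordinates vary slowly if the triangle contains a large disc. -/
theorem abs_sub_le (h : IsBary T lam) {c : Plane} {R : ℝ} (hR : 0 < R)
    (hc : Metric.closedBall c R ⊆ hull T) {A : Plane} (hA : A ∈ T) (x y : Plane) :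
    2 * R * |lam A x - lam A y| ≤ dist x y := by
  -- The ends of a diameter parallel to `w` lie in the triangle, where the coordinate takes values
  -- in `[0, 1]`. So it changes by at most `1` over the length `2 * R`.
  have key : ∀ w : Plane, 2 * R * |(lam A).linear w| ≤ ‖w‖ := by
    intro w
    by_cases hw : w = 0
    · simp [hw]
    have hn : 0 < ‖w‖ := norm_pos_iff.2 hw
    have hm : ∀ σ : ℝ, |σ| = 1 → c + (σ * R / ‖w‖) • w ∈ hull T := by
      intro σ hσ
      refine hc ?_
      rw [Metric.mem_closedBall, dist_eq_norm, add_sub_cancel_left, norm_smul, norm_div, norm_mul,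
        Real.norm_eq_abs, hσ, norm_norm, Real.norm_of_nonneg hR.le, one_mul,
        div_mul_cancel₀ _ hn.ne']
    have hv : ∀ σ : ℝ, |σ| = 1 →
        0 ≤ lam A c + σ * R / ‖w‖ * (lam A).linear w ∧
          lam A c + σ * R / ‖w‖ * (lam A).linear w ≤ 1 := by
      intro σ hσ
      have e : lam A (c + (σ * R / ‖w‖) • w) = lam A c + σ * R / ‖w‖ * (lam A).linear w := by
        have := (lam A).map_vadd c ((σ * R / ‖w‖) • w)
        rw [vadd_eq_add, add_comm] at this
        rw [this]
        simp [add_comm]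
      rw [← e]
      exact ⟨(h.mem_hull _).1 (hm σ hσ) A hA, h.le_one hA (hm σ hσ)⟩
    obtain ⟨h1, h2⟩ := hv 1 (by simp)
    obtain ⟨h3, h4⟩ := hv (-1) (by simp)
    have h5 : |R / ‖w‖ * (lam A).linear w| ≤ 1 / 2 := by
      rw [abs_le]
      constructor
      · have : (-1 : ℝ) * R / ‖w‖ * (lam A).linear w = -(R / ‖w‖ * (lam A).linear w) := by ring
        rw [this] at h3 h4
        rw [one_mul] at h1 h2
        linarith
      · have : (-1 : ℝ) * R / ‖w‖ * (lam A).linear w = -(R / ‖w‖ * (lam A).linear w) := by ring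
        rw [this] at h3 h4
        rw [one_mul] at h1 h2
        linarith
    rw [abs_mul, abs_of_pos (div_pos hR hn), div_mul_eq_mul_div, div_le_iff₀ hn] at h5
    linarith
  have := key (x - y)
  rw [← vsub_eq_sub, AffineMap.linearMap_vsub, vsub_eq_sub, vsub_eq_sub] at this
  rwa [dist_eq_norm]

theorem eq_zero_of_mem_convexHull (h : IsBary T lam) {S : Set Plane} (hS : S ⊆ T) {Q : Plane}
    (hQ : Q ∈ T) (hQS : Q ∉ S) {x : Plane} (hx : x ∈ convexHull ℝ S) : lam Q x = 0 := by
  have hconv : Convex ℝ ((lam Q) ⁻¹' {0}) := (convex_singleton (0 : ℝ)).affine_preimage (lam Q)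
  exact convexHull_min (fun B hB => h.ne Q hQ B (hS hB) fun e => hQS (e ▸ hB)) hconv hx

end IsBary

theorem hull_pair (A B : Plane) : hull {A, B} = segment ℝ A B := by
  classical
  unfold hull
  rw [Finset.coe_pair, convexHull_pair]

theorem isCompact_hull (S : Finset Plane) : IsCompact (hull S) :=
  S.finite_toSet.isCompact_convexHull ℝ

theorem hull_mono {S T : Finset Plane} (h : S ⊆ T) : hull S ⊆ hull T :=
  convexHull_mono (Finset.coe_subset.2 h)

theorem dist_le_diamT {T : Finset Plane} {x y : Plane} (hx : x ∈ hull T) (hy : y ∈ hull T) :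
    dist x y ≤ diamT T :=
  Metric.dist_le_diam_of_mem (isCompact_hull T).isBounded hx hy

theorem Triangulation.diamT_le_meshSize (M : Triangulation) {T : Finset Plane}
    (hT : T ∈ M.elems) : diamT T ≤ M.meshSize := by
  unfold Triangulation.meshSize
  exact le_ciSup (f := fun T : {T // T ∈ M.elems} => diamT T.1)
    (Set.finite_range _).bddAbove ⟨T, hT⟩

theorem Triangulation.diamT_pos (M : Triangulation) {T : Finset Plane}
    (hT : T ∈ M.elems) : 0 < diamT T := by
  have hc := M.card_eq T hT
  obtain ⟨A, hA, B, hB, hAB⟩ := Finset.one_lt_card.1 (by omega : 1 < T.card)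
  exact (dist_pos.2 hAB).trans_le
    (dist_le_diamT (subset_convexHull ℝ _ hA) (subset_convexHull ℝ _ hB))

theorem two_mul_le_diamT {T : Finset Plane} {c : Plane} {R : ℝ} (hR : 0 < R)
    (hc : Metric.closedBall c R ⊆ hull T) : 2 * R ≤ diamT T := by
  obtain ⟨w, hw⟩ := exists_norm_eq Plane hR.le
  have h1 : c + w ∈ hull T := hc (by simp [hw])
  have h2 : c - w ∈ hull T := hc (by simp [hw])
  have h3 := dist_le_diamT h1 h2
  have h4 : dist (c + w) (c - w) = 2 * R := by
    rw [dist_eq_norm, show c + w - (c - w) = (2 : ℝ) • w by module, norm_smul, hw]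
    norm_num
  linarith

/-- The two halves of a disc around a point of an edge that are cut off by this edge. -/
theorem mem_hull_of_dist_le {A B Q : Plane} {T : Finset Plane}
    {lam : Plane → (Plane →ᵃ[ℝ] ℝ)} (h : IsBary T lam) (hT : ∀ X ∈ T, X = A ∨ X = B ∨ X = Q)
    {c : Plane} {R : ℝ} (hR : 0 < R)
    (hc : Metric.closedBall c R ⊆ hull T) {m y : Plane} (hA : 2 * R * lam A m ≥ dist y m)
    (hB : 2 * R * lam B m ≥ dist y m) (hQ : 0 ≤ lam Q y) : y ∈ hull T := by
  rw [h.mem_hull]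
  -- The coordinate at `m` is larger than its possible change between `m` and `y`, so the sides
  -- opposite `A` and `B` cannot be crossed.
  have aux : ∀ X ∈ T, 2 * R * lam X m ≥ dist y m → 0 ≤ lam X y := by
    intro X hX hm
    have h1 := h.abs_sub_le hR hc hX y m
    have h2 : -(lam X y - lam X m) ≤ |lam X y - lam X m| := neg_le_abs _
    have h3 : 2 * R * (-(lam X y - lam X m)) ≤ 2 * R * |lam X y - lam X m| :=
      mul_le_mul_of_nonneg_left h2 (by linarith)
    have h4 : 0 ≤ 2 * R * lam X y := by linarith
    exact nonneg_of_mul_nonneg_right h4 (by linarith)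
  intro X hX
  rcases hT X hX with rfl | rfl | rfl
  · exact aux _ hX hA
  · exact aux _ hX hB
  · exact hQ

/-- A disc whose center is on the nonnegative side of an affine function contains a disc of half
the radius on this side. -/
theorem exists_half_ball (f : Plane →ᵃ[ℝ] ℝ) {y : Plane} (hy : 0 ≤ f y) {τ : ℝ} (hτ : 0 < τ) :
    ∃ z : Plane, dist z y ≤ τ / 2 ∧ Metric.ball z (τ / 2) ⊆ Metric.ball y τ ∧
      ∀ x ∈ Metric.ball z (τ / 2), 0 ≤ f x := by
  let L : Plane →L[ℝ] ℝ := LinearMap.toContinuousLinearMap f.linear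
  let g : Plane := (InnerProductSpace.toDual ℝ Plane).symm L
  have hg : ∀ w, f.linear w = inner ℝ g w := fun w => by
    rw [InnerProductSpace.toDual_symm_apply]
    rfl
  have hf : ∀ w, f (y + w) = f y + inner ℝ g w := fun w => by
    have := f.map_vadd y w
    rw [vadd_eq_add, add_comm] at this
    rw [this, hg, vadd_eq_add, add_comm]
  -- Shifting the center by `τ / 2` along the gradient direction gains `‖g‖ * τ / 2`, which is the
  -- most that `f` can lose within radius `τ / 2`. For constant `f` no shift is needed.
  obtain ⟨n, hn, hgn⟩ : ∃ n : Plane, ‖n‖ ≤ 1 ∧ inner ℝ g n = ‖g‖ := by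
    by_cases h0 : g = 0
    · exact ⟨0, by simp, by simp [h0]⟩
    · have : ‖g‖ ≠ 0 := norm_ne_zero_iff.2 h0
      refine ⟨‖g‖⁻¹ • g, ?_, ?_⟩
      · rw [norm_smul, norm_inv, norm_norm, inv_mul_cancel₀ this]
      · rw [inner_smul_right, real_inner_self_eq_norm_sq]
        field_simp
  have hd : dist (y + (τ / 2) • n) y ≤ τ / 2 := by
    rw [dist_eq_norm, add_sub_cancel_left, norm_smul, Real.norm_of_nonneg (by linarith)]
    nlinarith
  refine ⟨y + (τ / 2) • n, hd, Metric.ball_subset_ball' (by linarith), fun x hx => ?_⟩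
  have e : x = y + ((τ / 2) • n + (x - (y + (τ / 2) • n))) := by abel
  rw [e, hf, inner_add_right, inner_smul_right, hgn]
  have h1 := abs_real_inner_le_norm g (x - (y + (τ / 2) • n))
  rw [Metric.mem_ball, dist_eq_norm] at hx
  have h2 : ‖g‖ * ‖x - (y + (τ / 2) • n)‖ ≤ ‖g‖ * (τ / 2) :=
    mul_le_mul_of_nonneg_left hx.le (norm_nonneg _)
  have h3 := neg_abs_le (inner ℝ g (x - (y + (τ / 2) • n)))
  linarith

theorem exists_third {T : Finset Plane} (hT : T.card = 3) {A B : Plane} (hAB : A ≠ B) (hA : A ∈ T)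
    (hB : B ∈ T) : ∃ Q ∈ T, Q ≠ A ∧ Q ≠ B ∧ ∀ X ∈ T, X = A ∨ X = B ∨ X = Q := by
  classical
  have h1 : ({A, B} : Finset Plane) ⊆ T := by
    intro X hX
    rcases Finset.mem_insert.1 hX with rfl | hX
    · exact hA
    · rw [Finset.mem_singleton.1 hX]; exact hB
  have h2 : (T \ {A, B}).card = 1 := by
    rw [Finset.card_sdiff_of_subset h1, hT, Finset.card_pair hAB]
  obtain ⟨Q, hQ⟩ := Finset.card_eq_one.1 h2
  have h3 : ∀ X, X ∈ T \ {A, B} ↔ X = Q := fun X => by rw [hQ, Finset.mem_singleton]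
  have h4 := (h3 Q).2 rfl
  simp only [Finset.mem_sdiff, Finset.mem_insert, Finset.mem_singleton, not_or] at h3 h4
  refine ⟨Q, h4.1, h4.2.1, h4.2.2, fun X hX => ?_⟩
  by_cases hXA : X = A
  · exact Or.inl hXA
  by_cases hXB : X = B
  · exact Or.inr (Or.inl hXB)
  · exact Or.inr (Or.inr ((h3 X).1 ⟨hX, hXA, hXB⟩))

/-- Two triangles with a common edge are on different sides of it. -/
theorem Triangulation.nonneg_or_nonneg (M : Triangulation) {S T : Finset Plane} (hS : S ∈ M.elems)
    (hT : T ∈ M.elems) (hST : S ≠ T) {A B Q Q' : Plane} (hA : A ∈ S) (hB : B ∈ S) (hA' : A ∈ T)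
    (hB' : B ∈ T) (hQ : Q ∈ S) (hQA : Q ≠ A) (hQB : Q ≠ B)
    (hS3 : ∀ X ∈ S, X = A ∨ X = B ∨ X = Q)
    (hQ' : Q' ∈ T) (hQA' : Q' ≠ A) (hQB' : Q' ≠ B)
    (hT3 : ∀ X ∈ T, X = A ∨ X = B ∨ X = Q')
    {lam lam' : Plane → (Plane →ᵃ[ℝ] ℝ)} (h : IsBary S lam) (h' : IsBary T lam')
    {c c' : Plane} {R R' : ℝ} (hR : 0 < R) (hR' : 0 < R')
    (hc : Metric.closedBall c R ⊆ hull S) (hc' : Metric.closedBall c' R' ⊆ hull T)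
    {m y : Plane} (hm : m ∈ segment ℝ A B) (hyA : 2 * R * lam A m ≥ dist y m)
    (hyB : 2 * R * lam B m ≥ dist y m) (hyA' : 2 * R' * lam' A m ≥ dist y m)
    (hyB' : 2 * R' * lam' B m ≥ dist y m) : 0 ≤ lam Q y ∨ 0 ≤ lam' Q' y := by
  classical
  by_contra hcon
  push Not at hcon
  have hmc : m ∈ convexHull ℝ ({A, B} : Set Plane) := by rwa [convexHull_pair]
  have hm0 : lam Q m = 0 := h.eq_zero_of_mem_convexHull
    (by intro X hX; rcases hX with rfl | rfl <;> assumption) hQ (by simp [hQA, hQB]) hmc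
  have hm0' : lam' Q' m = 0 := h'.eq_zero_of_mem_convexHull
    (by intro X hX; rcases hX with rfl | rfl <;> assumption) hQ' (by simp [hQA', hQB']) hmc
  -- If `y` were strictly outside both triangles, across the common edge, its reflection in `m`
  -- would lie in both. By conformity it would lie in the hull of the common vertices, where the
  -- coordinate of `Q` vanishes, although reflection has made it positive.
  set y' := m + (m - y) with hy'
  have hdist : dist y' m = dist y m := by
    rw [hy', dist_eq_norm, add_sub_cancel_left, dist_eq_norm, norm_sub_rev]
  have href : ∀ f : Plane →ᵃ[ℝ] ℝ, f m = 0 → f y' = - f y := by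
    intro f hf
    have h1 := f.map_vadd m (m - y)
    have h2 := f.linearMap_vsub m y
    rw [vadd_eq_add, vadd_eq_add, add_comm] at h1
    rw [vsub_eq_sub, vsub_eq_sub] at h2
    rw [hy', h1, h2, hf]
    ring
  have hin : y' ∈ hull S := mem_hull_of_dist_le h hS3 hR hc (by rw [hdist]; exact hyA)
    (by rw [hdist]; exact hyB) (by rw [href _ hm0]; linarith)
  have hin' : y' ∈ hull T := mem_hull_of_dist_le h' hT3 hR' hc' (by rw [hdist]; exact hyA')
    (by rw [hdist]; exact hyB') (by rw [href _ hm0']; linarith)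
  have hmem : y' ∈ hull S ∩ hull T := ⟨hin, hin'⟩
  rw [M.conforming S hS T hT] at hmem
  have hQT : Q ∉ T := by
    intro hQT
    refine hST (Finset.eq_of_subset_of_card_le (fun X hX => ?_)
      (by rw [M.card_eq S hS, M.card_eq T hT]))
    rcases hS3 X hX with rfl | rfl | rfl <;> assumption
  have h0 := h.eq_zero_of_mem_convexHull (Q := Q) inter_subset_left hQ
    (fun hh => hQT hh.2) hmem
  rw [href _ hm0] at h0
  linarith [hcon.1]

/-! ### The parts of an edge -/

open AffineMap (lineMap)

theorem hull_pair_eq_image (A B : Plane) : hull {A, B} = lineMap A B '' Icc (0 : ℝ) 1 := by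
  rw [hull_pair, segment_eq_image_lineMap]

theorem Triangulation.card_of_mem_intEdges (M : Triangulation) {e : Finset Plane} (he : e ∈ M.intEdges) :
    e.card = 2 := by
  classical
  unfold Triangulation.intEdges Triangulation.edges at he
  simp only [Finset.mem_filter, Finset.mem_biUnion, Finset.mem_powersetCard] at he
  obtain ⟨⟨T, _, _, h⟩, _⟩ := he
  exact h

/-- The interface meets an open edge in at most one point. -/
theorem Interface.H2.eq_of_mem_curve {I : Interface} {M : Triangulation} (h2 : I.H2 M)
    {T : Finset Plane} (hT : T ∈ M.elems) {A B : Plane} (hAB : A ≠ B) (hA : A ∈ T) (hB : B ∈ T)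
    {t t' : ℝ} (ht : t ∈ Ioo (0 : ℝ) 1) (ht' : t' ∈ Ioo (0 : ℝ) 1)
    (hc : lineMap A B t ∈ I.curve) (hc' : lineMap A B t' ∈ I.curve) : t = t' := by
  classical
  obtain ⟨lam, h⟩ := M.exists_isBary hT
  obtain ⟨Q, hQ, hQA, hQB, hT3⟩ := exists_third (M.card_eq T hT) hAB hA hB
  have hlA : ∀ u : ℝ, lam A (lineMap A B u) = 1 - u := fun u => by
    rw [AffineMap.apply_lineMap, h.self A hA, h.ne A hA B hB hAB.symm, AffineMap.lineMap_apply]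
    simp
    ring
  have hlB : ∀ u : ℝ, lam B (lineMap A B u) = u := fun u => by
    rw [AffineMap.apply_lineMap, h.self B hB, h.ne B hB A hA hAB, AffineMap.lineMap_apply]
    simp
  have hlQ : ∀ u : ℝ, lam Q (lineMap A B u) = 0 := fun u => by
    rw [AffineMap.apply_lineMap, h.ne Q hQ A hA hQA.symm, h.ne Q hQ B hB hQB.symm,
      AffineMap.lineMap_apply]
    simp
  have hfr : ∀ u ∈ Ioo (0 : ℝ) 1, lineMap A B u ∈ frontier (hull T) := fun u hu => by
    refine ⟨subset_closure ((h.mem_hull _).2 fun X hX => ?_), fun hint => ?_⟩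
    · rcases hT3 X hX with rfl | rfl | rfl
      · rw [hlA]; linarith [hu.2]
      · rw [hlB]; exact hu.1.le
      · rw [hlQ]
    · have := (h.mem_interior _).1 hint Q hQ
      rw [hlQ] at this
      exact lt_irrefl _ this
  -- A relatively interior point of the edge has positive coordinates at `A` and `B`, so it lies on
  -- no other edge, and (H2) cannot hold for two such points of the curve.
  have hed : ∀ u ∈ Ioo (0 : ℝ) 1, ∀ e ∈ T.powersetCard 2, lineMap A B u ∈ hull e →
      e = {A, B} := fun u hu e he hue => by
    rw [Finset.mem_powersetCard] at he
    have hAe : A ∈ e := by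
      by_contra hAe
      have := h.eq_zero_of_mem_convexHull (Finset.coe_subset.2 he.1) hA
        (by exact_mod_cast hAe) hue
      rw [hlA] at this
      linarith [hu.2]
    have hBe : B ∈ e := by
      by_contra hBe
      have := h.eq_zero_of_mem_convexHull (Finset.coe_subset.2 he.1) hB
        (by exact_mod_cast hBe) hue
      rw [hlB] at this
      linarith [hu.1]
    symm
    refine Finset.eq_of_subset_of_card_le (fun X hX => ?_)
      (by rw [he.2, Finset.card_pair hAB])
    rcases Finset.mem_insert.1 hX with rfl | hX
    · exact hAe
    · rw [Finset.mem_singleton.1 hX]; exact hBe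
  by_contra htt
  have hne : lineMap A B t ≠ lineMap A B t' := fun heq =>
    htt ((AffineMap.lineMap_injective ℝ hAB) heq)
  obtain ⟨e, he, e', he', hee, hx, hy⟩ := h2 T hT _ ⟨hfr t ht, hc⟩ _ ⟨hfr t' ht', hc'⟩ hne
  exact hee ((hed t ht e he hx).trans (hed t' ht' e' he' hy).symm)

theorem continuous_lineMap (A B : Plane) : Continuous (fun t : ℝ => lineMap A B t) :=
  AffineMap.lineMap_continuous

/-- The parameter `t` may be an endpoint of the interval, for instance a vertex of the mesh: the
side is open, so it also contains nearby interior points, and connectedness does the rest. -/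
theorem Interface.image_Ioo_subset_region (I : Interface) {A B : Plane} {a b t : ℝ} (hab : a < b)
    (hc : ∀ u ∈ Ioo a b, lineMap A B u ∉ I.curve) {s : Side} (ht : t ∈ Icc a b)
    (hts : lineMap A B t ∈ I.region s) : ∀ u ∈ Ioo a b, lineMap A B u ∈ I.region s := by
  have hop : IsOpen ((fun u : ℝ => lineMap A B u) ⁻¹' I.region s) :=
    (I.region_open s).preimage (continuous_lineMap A B)
  rw [← closure_Ioo hab.ne] at ht
  obtain ⟨u0, hu0, hu0'⟩ := mem_closure_iff.1 ht _ hop hts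
  have hpre : IsPreconnected ((fun u : ℝ => lineMap A B u) '' Ioo a b) :=
    isPreconnected_Ioo.image _ (continuous_lineMap A B).continuousOn
  have := I.subset_region hpre (by
    rw [disjoint_left]
    rintro _ ⟨u, hu, rfl⟩
    exact hc u hu) (mem_image_of_mem _ hu0') hu0
  exact fun u hu => this (mem_image_of_mem _ hu)

/-- The part of an edge on one side of the interface contains an interval of comparable size. -/
theorem Interface.exists_Ioo_subset_region (I : Interface) {A B : Plane}
    (hc : ∀ t ∈ Ioo (0 : ℝ) 1, ∀ t' ∈ Ioo (0 : ℝ) 1, lineMap A B t ∈ I.curve →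
      lineMap A B t' ∈ I.curve → t = t') {s : Side} {t₀ : ℝ} (ht₀ : t₀ ∈ Icc (0 : ℝ) 1)
    (hs : lineMap A B t₀ ∈ I.region s) :
    ∃ u v : ℝ, 0 ≤ u ∧ u < v ∧ v ≤ 1 ∧ (∀ t ∈ Ioo u v, lineMap A B t ∈ I.region s) ∧
      ∀ t ∈ Icc (0 : ℝ) 1, lineMap A B t ∈ I.region s → |t - (u + v) / 2| ≤ 2 * (v - u) := by
  by_cases hex : ∃ t₁ ∈ Ioo (0 : ℝ) 1, lineMap A B t₁ ∈ I.curve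
  · obtain ⟨t₁, ht₁, htc⟩ := hex
    have hno : ∀ u ∈ Ioo (0 : ℝ) 1, u ≠ t₁ → lineMap A B u ∉ I.curve :=
      fun u hu hne huc => hne (hc u hu t₁ ht₁ huc htc)
    have hleft : ∀ t ∈ Icc 0 t₁, lineMap A B t ∈ I.region s →
        ∀ u ∈ Ioo 0 t₁, lineMap A B u ∈ I.region s := fun t ht hts =>
      I.image_Ioo_subset_region ht₁.1 (fun u hu => hno u ⟨hu.1, hu.2.trans ht₁.2⟩ hu.2.ne) ht hts
    have hright : ∀ t ∈ Icc t₁ 1, lineMap A B t ∈ I.region s →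
        ∀ u ∈ Ioo t₁ 1, lineMap A B u ∈ I.region s := fun t ht hts =>
      I.image_Ioo_subset_region ht₁.2 (fun u hu => hno u ⟨ht₁.1.trans hu.1, hu.2⟩ hu.1.ne') ht hts
    obtain ⟨h0, h1⟩ := ht₁
    by_cases hL : ∃ t ∈ Icc 0 t₁, lineMap A B t ∈ I.region s
    · obtain ⟨tl, htl, htls⟩ := hL
      by_cases hR : ∃ t ∈ Icc t₁ 1, lineMap A B t ∈ I.region s
      · obtain ⟨tr, htr, htrs⟩ := hR
        -- Here the curve touches the edge without changing sides. The longer piece has length at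
        -- least `1 / 2`, so twice its length covers the whole edge; this case dictates the factor
        -- `2`.
        rcases le_total t₁ (1 / 2) with hh | hh
        · refine ⟨t₁, 1, h0.le, h1, le_rfl, hright tr htr htrs, fun t ht _ => ?_⟩
          rw [abs_le]
          constructor <;> linarith [ht.1, ht.2]
        · refine ⟨0, t₁, le_rfl, h0, h1.le, hleft tl htl htls, fun t ht _ => ?_⟩
          rw [abs_le]
          constructor <;> linarith [ht.1, ht.2]
      · push Not at hR
        refine ⟨0, t₁, le_rfl, h0, h1.le, hleft tl htl htls, fun t ht hts => ?_⟩
        have : t < t₁ := by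
          by_contra hlt
          exact hR t ⟨not_lt.1 hlt, ht.2⟩ hts
        rw [abs_le]
        constructor <;> linarith [ht.1, ht.2]
    · push Not at hL
      have hlt : ∀ t ∈ Icc (0 : ℝ) 1, lineMap A B t ∈ I.region s → t₁ < t := fun t ht hts => by
        by_contra hlt
        exact hL t ⟨ht.1, not_lt.1 hlt⟩ hts
      refine ⟨t₁, 1, h0.le, h1, le_rfl, hright t₀ ⟨(hlt t₀ ht₀ hs).le, ht₀.2⟩ hs,
        fun t ht hts => ?_⟩
      have := hlt t ht hts
      rw [abs_le]
      constructor <;> linarith [ht.1, ht.2]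
  · push Not at hex
    refine ⟨0, 1, le_rfl, one_pos, le_rfl, I.image_Ioo_subset_region one_pos hex ht₀ hs,
      fun t ht _ => ?_⟩
    rw [abs_le]
    constructor <;> linarith [ht.1, ht.2]

/-- On one of the two elements at an interior edge, the part on a given side of the interface
contains a disc that is as large as the part of the edge on this side. -/
theorem exists_ball_subset_part {ρ r : ℝ} (hρ : 0 < ρ) {M : Mesh} {I : Interface}
    (hreg : M.ShapeRegular ρ) (h2 : I.H2 M.toTriangulation) (hr : I.TubularRadius r)
    (hmesh : M.meshSize < r / 2) {e : Finset Plane} (he : e ∈ M.intEdges) {s : Side}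
    (hne : (I.part e s).Nonempty) :
    ∃ T, (T = M.first e ∨ T = M.second e) ∧ ∃ (z : Plane) (R : ℝ), 0 < R ∧
      Metric.ball z R ⊆ I.part T s ∧
      I.part e s ⊆ Metric.closedBall z ((32 / ρ + 3) * R) ∧
      (Measure.hausdorffMeasure 1 : Measure Plane) (I.part e s) ≤
        ENNReal.ofReal ((32 / ρ + 3) * R) := by
  classical
  obtain ⟨hS, heS⟩ := M.first_mem e he
  obtain ⟨hT, heT⟩ := M.second_mem e he
  have hST := M.first_ne_second e he
  generalize M.first e = S at *
  generalize M.second e = T at *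
  obtain ⟨A, B, hAB, rfl⟩ := Finset.card_eq_two.1 (Triangulation.card_of_mem_intEdges _ he)
  have hAS : A ∈ S := heS (by simp)
  have hBS : B ∈ S := heS (by simp)
  have hAT : A ∈ T := heT (by simp)
  have hBT : B ∈ T := heT (by simp)
  obtain ⟨Q, hQ, hQA, hQB, hS3⟩ := exists_third (M.card_eq S hS) hAB hAS hBS
  obtain ⟨Q', hQ', hQA', hQB', hT3⟩ := exists_third (M.card_eq T hT) hAB hAT hBT
  obtain ⟨lam, h⟩ := M.exists_isBary hS
  obtain ⟨lam', h'⟩ := M.exists_isBary hT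
  obtain ⟨c, hc⟩ := hreg S hS
  obtain ⟨c', hc'⟩ := hreg T hT
  have hdS := M.diamT_pos hS
  have hdT := M.diamT_pos hT
  have hR1 : 0 < ρ * diamT S / 2 := by positivity
  have hR2 : 0 < ρ * diamT T / 2 := by positivity
  have hmS := M.diamT_le_meshSize hS
  have hABS : dist A B ≤ diamT S :=
    dist_le_diamT (subset_convexHull ℝ _ hAS) (subset_convexHull ℝ _ hBS)
  have hABT : dist A B ≤ diamT T :=
    dist_le_diamT (subset_convexHull ℝ _ hAT) (subset_convexHull ℝ _ hBT)
  have hAB0 : 0 < dist A B := dist_pos.2 hAB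
  -- A disc of diameter `ρ h_T` inside `T` cannot be wider than `h_T`.
  have hρ1 : ρ ≤ 1 := by
    have := two_mul_le_diamT hR1 hc
    by_contra hlt
    nlinarith
  obtain ⟨x₀, hx₀, hx₀s⟩ := hne
  rw [hull_pair_eq_image] at hx₀
  obtain ⟨t₀, ht₀, rfl⟩ := hx₀
  obtain ⟨u, v, hu, huv, hv, hIoo, hall⟩ := I.exists_Ioo_subset_region
    (fun t ht t' ht' => h2.eq_of_mem_curve hS hAB hAS hBS ht ht') ht₀ hx₀s
  set m : Plane := lineMap A B ((u + v) / 2) with hm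
  have hms : m ∈ I.region s := hIoo _ ⟨by linarith, by linarith⟩
  set l : ℝ := (v - u) * dist A B with hl
  have hl0 : 0 < l := mul_pos (by linarith) hAB0
  have hlS : l ≤ diamT S := by
    refine le_trans ?_ hABS
    exact mul_le_of_le_one_left hAB0.le (by linarith)
  -- Small enough for `τ ≤ r / 4`, since `l ≤ h < r / 2`, and for the disc of radius `2 * τ` around
  -- `m` to stay away from the other edges of both triangles.
  set τ : ℝ := ρ * l / 4 with hτ
  have hτ0 : 0 < τ := by positivity
  have hρl : ρ * l ≤ l := mul_le_of_le_one_left hl0.le hρ1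
  obtain ⟨ν, hν, hball⟩ := hr.exists_ball_subset hms hτ0 (by linarith)
  have hy₀ : dist (m + τ • ν) m = τ := by
    rw [dist_eq_norm, add_sub_cancel_left, norm_smul, hν, mul_one, Real.norm_of_nonneg hτ0.le]
  set y₀ := m + τ • ν with hy₀'
  have hmid : (v - u) / 2 ≤ (u + v) / 2 := by linarith
  have hmid' : (v - u) / 2 ≤ 1 - (u + v) / 2 := by linarith
  -- Both coordinates at `m` are at least `(v - u) / 2`, and `ρ * diamT U * (v - u) / 2 ≥ ρ * l / 2
  -- = 2 * τ`.
  have bary : ∀ (U : Finset Plane) (mu : Plane → (Plane →ᵃ[ℝ] ℝ)), IsBary U mu → A ∈ U → B ∈ U →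
      dist A B ≤ diamT U → 2 * τ ≤ 2 * (ρ * diamT U / 2) * mu A m ∧
        2 * τ ≤ 2 * (ρ * diamT U / 2) * mu B m := by
    intro U mu hb hAU hBU hd
    have e1 : mu A m = 1 - (u + v) / 2 := by
      rw [hm, AffineMap.apply_lineMap, hb.self A hAU, hb.ne A hAU B hBU hAB.symm,
        AffineMap.lineMap_apply]
      simp
      ring
    have e2 : mu B m = (u + v) / 2 := by
      rw [hm, AffineMap.apply_lineMap, hb.self B hBU, hb.ne B hBU A hAU hAB,
        AffineMap.lineMap_apply]
      simp
    have key : 2 * τ ≤ ρ * diamT U * ((v - u) / 2) := by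
      have : ρ * dist A B * ((v - u) / 2) ≤ ρ * diamT U * ((v - u) / 2) := by
        refine mul_le_mul_of_nonneg_right (mul_le_mul_of_nonneg_left hd hρ.le) (by linarith)
      refine le_trans (le_of_eq ?_) this
      rw [hτ, hl]
      ring
    have hd0 : 0 ≤ ρ * diamT U := mul_nonneg hρ.le (hAB0.le.trans hd)
    rw [e1, e2]
    constructor
    · have := mul_le_mul_of_nonneg_left hmid' hd0
      linarith
    · have := mul_le_mul_of_nonneg_left hmid hd0
      linarith
  obtain ⟨bA, bB⟩ := bary S lam h hAS hBS hABS
  obtain ⟨bA', bB'⟩ := bary T lam' h' hAT hBT hABT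
  have hmseg : m ∈ segment ℝ A B := by
    rw [segment_eq_image_lineMap]
    exact ⟨_, ⟨by linarith, by linarith⟩, rfl⟩
  have hside := M.nonneg_or_nonneg hS hT hST hAS hBS hAT hBT hQ hQA hQB hS3 hQ' hQA' hQB' hT3 h h'
    hR1 hR2 hc hc' hmseg (y := y₀) (by linarith) (by linarith) (by linarith) (by linarith)
  -- The center `y₀` is on the inner side of the edge for `S` or for `T`. The half-size disc on that
  -- side remains within `2 * τ` of `m`, hence in the triangle.
  have hfin : ∃ U, (U = S ∨ U = T) ∧ ∃ z, dist z y₀ ≤ τ / 2 ∧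
      Metric.ball z (τ / 2) ⊆ I.part U s := by
    rcases hside with hs | hs
    · obtain ⟨z, hz, hzsub, hznn⟩ := exists_half_ball _ hs hτ0
      refine ⟨S, Or.inl rfl, z, hz, fun x hx => ⟨?_, hball (hzsub hx)⟩⟩
      have hxm : dist x m ≤ 2 * τ := by
        have h1 := dist_triangle x y₀ m
        have h2 := Metric.mem_ball.1 (hzsub hx)
        linarith
      exact mem_hull_of_dist_le (m := m) h hS3 hR1 hc (by linarith) (by linarith) (hznn x hx)
    · obtain ⟨z, hz, hzsub, hznn⟩ := exists_half_ball _ hs hτ0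
      refine ⟨T, Or.inr rfl, z, hz, fun x hx => ⟨?_, hball (hzsub hx)⟩⟩
      have hxm : dist x m ≤ 2 * τ := by
        have h1 := dist_triangle x y₀ m
        have h2 := Metric.mem_ball.1 (hzsub hx)
        linarith
      exact mem_hull_of_dist_le (m := m) h' hT3 hR2 hc' (by linarith) (by linarith) (hznn x hx)
  obtain ⟨U, hU, z, hz, hzU⟩ := hfin
  -- Origin of the constant: `e^s` is within `2 * l` of `m` and has length at most `4 * l = (32 / ρ)
  -- * (τ / 2)`, while `m` is within `τ + τ / 2` of `z`.
  have hKR : (32 / ρ + 3) * (τ / 2) = 4 * l + 3 * (τ / 2) := by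
    rw [hτ]
    field_simp
    ring
  refine ⟨U, hU, z, τ / 2, by positivity, hzU, ?_, ?_⟩
  · rintro x ⟨hx, hxs⟩
    rw [hull_pair_eq_image] at hx
    obtain ⟨t, ht, rfl⟩ := hx
    have h1 := hall t ht hxs
    have h3 : dist (lineMap A B t) m ≤ 2 * l := by
      rw [hm, dist_lineMap_lineMap, Real.dist_eq, hl]
      have := mul_le_mul_of_nonneg_right h1 hAB0.le
      linarith
    rw [Metric.mem_closedBall, hKR]
    have h4 := dist_triangle (lineMap A B t) m z
    have h5 := dist_triangle m y₀ z
    rw [dist_comm m y₀, dist_comm y₀ z] at h5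
    linarith
  · set a := (u + v) / 2 - 2 * (v - u) with ha
    set b := (u + v) / 2 + 2 * (v - u) with hb
    -- The parameters `a` and `b` may leave `[0, 1]`; only a segment of length `4 * l` on the line
    -- through the edge is needed.
    have hsub : I.part {A, B} s ⊆ segment ℝ (lineMap A B a) (lineMap A B b) := by
      rintro x ⟨hx, hxs⟩
      rw [hull_pair_eq_image] at hx
      obtain ⟨t, ht, rfl⟩ := hx
      have h1 := abs_le.1 (hall t ht hxs)
      have h3 : t ∈ segment ℝ a b := by
        rw [segment_eq_Icc (by linarith)]
        exact ⟨by linarith [h1.1], by linarith [h1.2]⟩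
      rw [← image_segment ℝ (lineMap A B)]
      exact mem_image_of_mem _ h3
    refine (measure_mono hsub).trans ?_
    rw [hausdorffMeasure_segment, edist_dist]
    refine ENNReal.ofReal_le_ofReal ?_
    rw [hKR, dist_lineMap_lineMap, Real.dist_eq, show a - b = -(4 * (v - u)) by rw [ha, hb]; ring,
      abs_neg, abs_of_pos (by linarith), mul_assoc, ← hl]
    linarith

/-- On an element that does not meet the interface, the same holds for all its edges. -/
theorem exists_ball_subset_part_of_disjoint {ρ : ℝ} (hρ : 0 < ρ) {M : Triangulation}
    {I : Interface} (hreg : M.ShapeRegular ρ) {T e : Finset Plane} (hT : T ∈ M.elems)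
    (hd : Disjoint (hull T) I.curve) (he : e ∈ M.intEdges) (heT : e ⊆ T) {s : Side}
    (hne : (I.part e s).Nonempty) :
    ∃ (z : Plane) (R : ℝ), 0 < R ∧
      Metric.ball z R ⊆ I.part T s ∧
      I.part e s ⊆ Metric.closedBall z ((32 / ρ + 3) * R) ∧
      (Measure.hausdorffMeasure 1 : Measure Plane) (I.part e s) ≤
        ENNReal.ofReal ((32 / ρ + 3) * R) := by
  classical
  obtain ⟨c, hc⟩ := hreg T hT
  have hdT := M.diamT_pos hT
  have hR : 0 < ρ * diamT T / 2 := by positivity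
  -- Far from sharp: the constant is that of `exists_ball_subset_part`, so that both cases use the
  -- same trace inequality.
  have hKR : diamT T ≤ (32 / ρ + 3) * (ρ * diamT T / 2) := by
    have : (32 / ρ + 3) * (ρ * diamT T / 2) = 16 * diamT T + 3 * (ρ * diamT T / 2) := by
      field_simp
      ring
    linarith
  obtain ⟨x₀, hx₀, hx₀s⟩ := hne
  have hTs : hull T ⊆ I.region s :=
    I.subset_region (convex_convexHull ℝ _).isPreconnected hd (hull_mono heT hx₀) hx₀s
  refine ⟨c, ρ * diamT T / 2, hR, fun x hx => ?_, fun x hx => ?_, ?_⟩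
  · have := hc (Metric.ball_subset_closedBall hx)
    exact ⟨this, hTs this⟩
  · exact (dist_le_diamT (hull_mono heT hx.1) (hc (Metric.mem_closedBall_self hR.le))).trans hKR
  · obtain ⟨A, B, hAB, rfl⟩ := Finset.card_eq_two.1 (Triangulation.card_of_mem_intEdges _ he)
    refine (measure_mono inter_subset_left).trans ?_
    rw [hull_pair, hausdorffMeasure_segment, edist_dist]
    refine ENNReal.ofReal_le_ofReal (le_trans ?_ hKR)
    exact dist_le_diamT (subset_convexHull ℝ _ (heT (by simp)))
      (subset_convexHull ℝ _ (heT (by simp)))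

/-! ### Cauchy–Schwarz inequalities -/

/-- Integrating a pointwise nonnegative quadratic polynomial in `t` gives a nonnegative one, whose
discriminant is at most zero. Stated for three functions, this covers products on edges, weighted
products on the curve and the Frobenius product alike. -/
theorem abs_integral_le_sqrt_mul_sqrt {α : Type*} [MeasurableSpace α] {μ : Measure α}
    {F G H : α → ℝ} (hF : Integrable F μ) (hG : Integrable G μ) (hH : Integrable H μ)
    (hF0 : ∀ x, 0 ≤ F x) (h : ∀ x (t : ℝ), 0 ≤ F x * (t * t) + 2 * H x * t + G x) :
    |∫ x, H x ∂μ| ≤ √(∫ x, F x ∂μ) * √(∫ x, G x ∂μ) := by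
  have key : ∀ t : ℝ, 0 ≤ (∫ x, F x ∂μ) * (t * t) + (2 * ∫ x, H x ∂μ) * t + ∫ x, G x ∂μ := by
    intro t
    have h1 : ∫ x, (F x * (t * t) + 2 * H x * t + G x) ∂μ =
        (∫ x, F x ∂μ) * (t * t) + (2 * ∫ x, H x ∂μ) * t + ∫ x, G x ∂μ := by
      have i1 : Integrable (fun x => F x * (t * t)) μ := hF.mul_const _
      have i2 : Integrable (fun x => 2 * H x * t) μ := (hH.const_mul 2).mul_const t
      have i3 : Integrable (fun x => F x * (t * t) + 2 * H x * t) μ := i1.add i2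
      rw [integral_add i3 hG, integral_add i1 i2, integral_mul_const,
        integral_mul_const, integral_const_mul]
    rw [← h1]
    exact integral_nonneg fun x => h x t
  have hd := discrim_le_zero key
  unfold discrim at hd
  rw [← Real.sqrt_mul (integral_nonneg hF0)]
  refine Real.abs_le_sqrt ?_
  linarith

theorem mul_le_sqrt_mul_sqrt {c X Y Z : ℝ} (hc : 0 ≤ c) (h : |Z| ≤ √X * √Y) :
    c * Z ≤ √(c * X) * √(c * Y) := by
  rw [Real.sqrt_mul hc, Real.sqrt_mul hc]
  have h1 : √c * √c = c := Real.mul_self_sqrt hc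
  calc c * Z ≤ c * (√X * √Y) := mul_le_mul_of_nonneg_left ((le_abs_self _).trans h) hc
    _ = √c * √c * (√X * √Y) := by rw [h1]
    _ = _ := by ring

theorem sum_sum_le_sqrt_mul_sqrt {ι κ : Type*} [Fintype κ] (s : Finset ι) {a x y : ι → κ → ℝ}
    (hx : ∀ i k, 0 ≤ x i k) (hy : ∀ i k, 0 ≤ y i k)
    (h : ∀ i ∈ s, ∀ k, a i k ≤ √(x i k) * √(y i k)) :
    ∑ i ∈ s, ∑ k, a i k ≤ √(∑ i ∈ s, ∑ k, x i k) * √(∑ i ∈ s, ∑ k, y i k) := by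
  rw [← Finset.sum_product', ← Finset.sum_product', ← Finset.sum_product']
  refine le_trans (Finset.sum_le_sum fun i hi => ?_) (Real.sum_sqrt_mul_sqrt_le
    (s ×ˢ (Finset.univ : Finset κ)) (f := fun i => x i.1 i.2) (g := fun i => y i.1 i.2)
    (fun i => hx _ _) (fun i => hy _ _))
  exact h _ (Finset.mem_product.1 hi).1 _

theorem hausdorffMeasure_hull_lt_top {e : Finset Plane} (he : e.card = 2) :
    (Measure.hausdorffMeasure 1 : Measure Plane) (hull e) < ⊤ := by
  classical
  obtain ⟨A, B, -, rfl⟩ := Finset.card_eq_two.1 he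
  rw [hull_pair, hausdorffMeasure_segment]
  exact edist_lt_top _ _

theorem hausdorffMeasure_part_lt_top (I : Interface) {e : Finset Plane} (he : e.card = 2)
    (s : Side) : (Measure.hausdorffMeasure 1 : Measure Plane) (I.part e s) < ⊤ :=
  (measure_mono inter_subset_left).trans_lt (hausdorffMeasure_hull_lt_top he)

theorem integrableOn_part (I : Interface) {e : Finset Plane} (he : e.card = 2)
    (s : Side) {f : Plane → ℝ} (hf : Continuous f) :
    IntegrableOn f (I.part e s) (Measure.hausdorffMeasure 1 : Measure Plane) := by
  obtain ⟨C, hC⟩ := (isCompact_hull e).exists_bound_of_continuousOn hf.continuousOn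
  refine Measure.integrableOn_of_bounded (hausdorffMeasure_part_lt_top I he s).ne
    hf.aestronglyMeasurable (M := C) ?_
  refine (ae_restrict_iff' ?_).2 (Filter.Eventually.of_forall fun x hx => hC x hx.1)
  exact (isCompact_hull e).isClosed.measurableSet.inter (I.region_open s).measurableSet

theorem lineInt_nonneg (S : Set Plane) {f : Plane → ℝ} (hf : ∀ x, 0 ≤ f x) : 0 ≤ lineInt S f :=
  integral_nonneg hf

theorem abs_lineInt_mul_le (I : Interface) {e : Finset Plane} (he : e.card = 2) (s : Side)
    {f g : Plane → ℝ} (hf : Continuous f) (hg : Continuous g) :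
    |lineInt (I.part e s) fun x => f x * g x| ≤
      √(lineInt (I.part e s) fun x => f x ^ 2) * √(lineInt (I.part e s) fun x => g x ^ 2) := by
  refine abs_integral_le_sqrt_mul_sqrt (integrableOn_part I he s (hf.pow 2))
    (integrableOn_part I he s (hg.pow 2)) (integrableOn_part I he s (hf.mul hg))
    (fun x => sq_nonneg _) fun x t => ?_
  nlinarith [sq_nonneg (f x * t + g x)]

namespace Interface

variable (I : Interface)

theorem integrableOn_param (S : Set Plane) {f : ℝ → ℝ} (hf : Continuous f) :
    IntegrableOn f {t | t ∈ Ico 0 I.period ∧ I.γ t ∈ S} :=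
  (hf.continuousOn.integrableOn_compact (isCompact_Icc (a := 0) (b := I.period))).mono_set
    fun _ ht => Ico_subset_Icc_self ht.1

theorem curveInt_nonneg (S : Set Plane) {f : ℝ → ℝ} (hf : ∀ x, 0 ≤ f x) : 0 ≤ I.curveInt S f :=
  integral_nonneg fun x => mul_nonneg (hf x) (norm_nonneg _)

theorem abs_curveInt_mul_le (S : Set Plane) {f g : ℝ → ℝ} (hf : Continuous f)
    (hg : Continuous g) :
    |I.curveInt S fun x => f x * g x| ≤
      √(I.curveInt S fun x => f x ^ 2) * √(I.curveInt S fun x => g x ^ 2) := by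
  have hn : Continuous fun t => ‖deriv I.γ t‖ := I.continuous_deriv_γ.norm
  refine abs_integral_le_sqrt_mul_sqrt (I.integrableOn_param S ((hf.pow 2).mul hn))
    (I.integrableOn_param S ((hg.pow 2).mul hn)) (I.integrableOn_param S ((hf.mul hg).mul hn))
    (fun x => mul_nonneg (sq_nonneg _) (norm_nonneg _)) fun x t => ?_
  have := mul_nonneg (sq_nonneg (f x * t + g x)) (norm_nonneg (deriv I.γ x))
  linarith

theorem continuous_tangent : Continuous I.tangent := by
  unfold tangent
  exact (I.continuous_deriv_γ.norm.inv₀ fun t => norm_ne_zero_iff.2 (I.regular t)).smul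
    I.continuous_deriv_γ

theorem continuous_tangent_apply (i : Fin 2) : Continuous fun t => I.tangent t i :=
  (continuous_apply i).comp ((PiLp.continuous_ofLp 2 _).comp I.continuous_tangent)

theorem continuous_normal_apply (i : Fin 2) : Continuous fun t => I.normal t i := by
  fin_cases i
  · exact (I.continuous_tangent_apply 1).neg.congr fun t => by simp [normal]
  · exact (I.continuous_tangent_apply 0).congr fun t => by simp [normal]

theorem continuous_jump0 (w : Pair) : Continuous (jump0 I w) :=
  ((continuous_val _).comp I.continuous_γ).sub ((continuous_val _).comp I.continuous_γ)

theorem continuous_jump1 (w : Pair) : Continuous (jump1 I w) := by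
  have h : ∀ q : Poly, Continuous fun t => dir1 (I.normal t) q (I.γ t) := fun q => by
    unfold dir1
    exact continuous_finsetSum _ fun i _ =>
      (I.continuous_normal_apply i).mul ((continuous_val _).comp I.continuous_γ)
  exact (h _).sub (h _)

theorem integrableOn_part_elem (T : Finset Plane) (s : Side) {f : Plane → ℝ} (hf : Continuous f) :
    IntegrableOn f (I.part T s) :=
  (hf.continuousOn.integrableOn_compact (isCompact_hull T)).mono_set inter_subset_left

theorem abs_integral_hessProd_le (T : Finset Plane) (s : Side) (q w : Poly) :
    |∫ x in I.part T s, hessProd q w x| ≤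
      √(∫ x in I.part T s, hessProd q q x) * √(∫ x in I.part T s, hessProd w w x) := by
  refine abs_integral_le_sqrt_mul_sqrt (I.integrableOn_part_elem T s (continuous_hessProd _ _))
    (I.integrableOn_part_elem T s (continuous_hessProd _ _))
    (I.integrableOn_part_elem T s (continuous_hessProd _ _)) (hessProd_self_nonneg q) fun x t => ?_
  have : hessProd q q x * (t * t) + 2 * hessProd q w x * t + hessProd w w x =
      ∑ i, ∑ j, (val (MvPolynomial.pderiv i (MvPolynomial.pderiv j q)) x * t +
        val (MvPolynomial.pderiv i (MvPolynomial.pderiv j w)) x) ^ 2 := by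
    simp only [hessProd, Fin.sum_univ_two]
    ring
  rw [this]
  exact Finset.sum_nonneg fun _ _ => Finset.sum_nonneg fun _ _ => sq_nonneg _

end Interface

/-! ### The trace inequality -/

theorem Mesh.norm_edgeNormal_le (M : Mesh) (e : Finset Plane) : ‖M.edgeNormal e‖ ≤ 1 := by
  unfold Mesh.edgeNormal
  rw [norm_smul, norm_inv, norm_norm]
  exact inv_mul_le_one

theorem length_nonneg (S : Set Plane) : 0 ≤ length S := measureReal_nonneg

/-- Trace inequality for second derivatives on a set of finite length close to a disc that is
contained in a part of an element. -/
theorem exists_length_mul_lineInt_le (p : ℕ) {K : ℝ} (hK : 0 ≤ K) :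
    ∃ C : ℝ, 0 < C ∧ ∀ q : Poly, IsP p q → ∀ (a : Plane), ‖a‖ ≤ 1 →
      ∀ (I : Interface) (s : Side) (T : Finset Plane) (E : Set Plane) (z : Plane) (R : ℝ),
      0 < R → Metric.ball z R ⊆ I.part T s → E ⊆ Metric.closedBall z (K * R) →
      (Measure.hausdorffMeasure 1 : Measure Plane) E ≤ ENNReal.ofReal (K * R) →
      length E * lineInt E (fun x => dir2 a a q x ^ 2) ≤
        C * ∫ x in I.part T s, hessProd q q x := by
  obtain ⟨C, hC, h⟩ := exists_dir2_sq_le_integral_ball p K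
  refine ⟨(K ^ 2 + 1) * C, by positivity,
    fun q hq a ha I s T E z R hR hsub hE hlen => ?_⟩
  have hKR : 0 ≤ K * R := mul_nonneg hK hR.le
  have hL : length E ≤ K * R := ENNReal.toReal_le_of_le_ofReal hKR hlen
  have hL0 := length_nonneg E
  set X := ∫ x in I.part T s, hessProd q q x with hX
  have hX0 : 0 ≤ X := integral_nonneg (hessProd_self_nonneg q)
  have hball : ∫ y in Metric.ball z R, hessProd q q y ≤ X :=
    setIntegral_mono_set (I.integrableOn_part_elem T s (continuous_hessProd _ _))
      (Filter.Eventually.of_forall (hessProd_self_nonneg q)) hsub.eventuallyLE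
  have hpt : ∀ x ∈ E, ‖dir2 a a q x ^ 2‖ ≤ C * X / R ^ 2 := fun x hx => by
    rw [Real.norm_of_nonneg (sq_nonneg _), le_div_iff₀ (by positivity), mul_comm]
    exact (h q hq a z R ha hR x (hE hx)).trans (mul_le_mul_of_nonneg_left hball hC.le)
  have hint : lineInt E (fun x => dir2 a a q x ^ 2) ≤ C * X / R ^ 2 * length E :=
    (le_abs_self _).trans (norm_setIntegral_le_of_norm_le_const
      (hlen.trans_lt ENNReal.ofReal_lt_top) hpt)
  -- One factor `length E` is the weight and the other comes from integrating the pointwise bound;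
  -- together they absorb `R ^ 2`. The `+ 1` in the constant keeps it positive when `K = 0`.
  calc length E * lineInt E (fun x => dir2 a a q x ^ 2)
      ≤ length E * (C * X / R ^ 2 * length E) := mul_le_mul_of_nonneg_left hint hL0
    _ = C * X / R ^ 2 * length E ^ 2 := by ring
    _ ≤ C * X / R ^ 2 * (K * R) ^ 2 := by gcongr
    _ = K ^ 2 * C * X := by field_simp
    _ ≤ (K ^ 2 + 1) * C * X := by gcongr; linarith

/-! ### Continuity of the bilinear form -/

theorem LocalIFE.isP {M : Mesh} {I : Interface} {B : Coeffs} {p : ℕ} {T : Finset Plane} {w : Pair}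
    (h : LocalIFE M I B p T w) (s : Side) : IsP p (w s) := by
  obtain ⟨ψ, v, c, hψ, rfl, -⟩ := h
  have hs : ∀ A ∈ nodes p T, ∀ s', IsP p (single s' (ψ A) s) := fun A hA s' => by
    unfold single
    split_ifs
    · exact (hψ A hA).1
    · simp [IsP]
  rw [Pi.add_apply, Finset.sum_apply, Finset.sum_apply]
  refine (MvPolynomial.totalDegree_add _ _).trans (max_le ?_ ?_)
  · exact isP_sum _ _ fun A hA => (hs A hA _).smul _
  · exact isP_sum _ _ fun A hA => (hs A hA _).smul _

/-- This degree bound is what the trace inequality takes from the finite element space, on cut and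
uncut elements alike. -/
theorem InIFESpace.isP {M : Mesh} {I : Interface} {B : Coeffs} {Ω : Set Plane} {p : ℕ} {u : Broken}
    (hu : InIFESpace M I B Ω p u) {T : Finset Plane} (hT : T ∈ M.elems) (s : Side) :
    IsP p (u T s) := by
  by_cases hI : T ∈ I.elemsI M.toTriangulation
  · exact (hu.local_ife T hI).isP s
  · obtain ⟨h1, h2⟩ := hu.local_std T hT hI
    cases s
    · rw [h2]; exact h1
    · exact h1

theorem Interface.intEdgesI_subset (I : Interface) (M : Triangulation) :
    I.intEdgesI M ⊆ M.intEdges := by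
  classical
  unfold intEdgesI
  exact Finset.filter_subset _ _

theorem Interface.intEdgesN_subset (I : Interface) (M : Triangulation) :
    I.intEdgesN M ⊆ M.intEdges := by
  classical
  unfold intEdgesN
  exact Finset.filter_subset _ _

theorem Interface.intEdgesNF_subset (I : Interface) (M : Triangulation) :
    I.intEdgesNF M ⊆ I.intEdgesN M := by
  classical
  unfold intEdgesNF
  exact Finset.filter_subset _ _

theorem Interface.sum_intEdges (I : Interface) (M : Triangulation) (f : Finset Plane → ℝ) :
    ∑ e ∈ M.intEdges, f e = ∑ e ∈ I.intEdgesI M, f e + ∑ e ∈ I.intEdgesN M, f e := by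
  classical
  unfold intEdgesI intEdgesN
  rw [Finset.sum_filter_add_sum_filter_not]

/-- A non-interface edge is on one side of the interface. -/
theorem Interface.part_eq_hull (I : Interface) {M : Triangulation} {e : Finset Plane}
    (he : e ∈ I.intEdgesN M) {s : Side} (hne : (I.part e s).Nonempty) : I.part e s = hull e := by
  classical
  unfold intEdgesN at he
  have h := not_nonempty_iff_eq_empty.1 (Finset.mem_filter.1 he).2
  obtain ⟨x, hx, hxs⟩ := hne
  exact inter_eq_left.2 (I.subset_region (convex_convexHull ℝ _).isPreconnected
    (disjoint_iff_inter_eq_empty.2 h) hx hxs)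

theorem lineInt_empty (f : Plane → ℝ) : lineInt ∅ f = 0 := by
  simp [lineInt]

/-- Each element has three edges. -/
theorem Triangulation.sum_intEdges_le (M : Triangulation) {F : Finset Plane → Finset Plane}
    (hF : ∀ e ∈ M.intEdges, F e ∈ M.elems ∧ e ⊆ F e) {g : Finset Plane → ℝ} (hg : ∀ T, 0 ≤ g T) :
    ∑ e ∈ M.intEdges, g (F e) ≤ 3 * ∑ T ∈ M.elems, g T := by
  classical
  rw [← Finset.sum_fiberwise_of_maps_to (fun e he => (hF e he).1), Finset.mul_sum]
  refine Finset.sum_le_sum fun T hT => ?_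
  have h1 : ∑ e ∈ M.intEdges with F e = T, g (F e) = ∑ e ∈ M.intEdges with F e = T, g T :=
    Finset.sum_congr rfl fun e he => by rw [(Finset.mem_filter.1 he).2]
  rw [h1, Finset.sum_const, nsmul_eq_mul]
  refine mul_le_mul_of_nonneg_right ?_ (hg T)
  have h2 : (M.intEdges.filter fun e => F e = T) ⊆ T.powersetCard 2 := fun e he => by
    rw [Finset.mem_filter] at he
    rw [Finset.mem_powersetCard]
    exact ⟨he.2 ▸ (hF e he.1).2, M.card_of_mem_intEdges he.1⟩
  have h3 := Finset.card_le_card h2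
  rw [Finset.card_powersetCard, M.card_eq T hT] at h3
  exact_mod_cast h3

theorem Coeffs.avg_pos (B : Coeffs) : 0 < B.avg := by
  have h1 := B.β_pos true
  have h2 := B.β_pos false
  unfold Coeffs.avg
  linarith

theorem diamT_nonneg (T : Finset Plane) : 0 ≤ diamT T := Metric.diam_nonneg

/-! ### The weighted squares that make up the norm -/

section Terms

variable (M : Mesh) (I : Interface) (B : Coeffs) (P : Penalty)

/-- Contribution of `T^s` to the squared norm. -/
noncomputable def bulkSq (v : Broken) (T : Finset Plane) (s : Side) : ℝ :=
  B.β s * ∫ x in I.part T s, hessProd (v T s) (v T s) x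

/-- Penalty for the normal derivative on `e^s`. -/
noncomputable def slopeSq (v : Broken) (e : Finset Plane) (s : Side) : ℝ :=
  P.σu * B.β s / length (I.part e s) * lineInt (I.part e s) (fun x => eJump1 M v e s x ^ 2)

/-- Penalty for the second normal derivative on `e^s`. -/
noncomputable def bendSq (v : Broken) (e : Finset Plane) (s : Side) : ℝ :=
  P.σF * length (I.part e s) * B.β s * lineInt (I.part e s) (fun x => eJump2 M v e s x ^ 2)

/-- Penalty for the values on `e^s`. -/
noncomputable def valueSq (v : Broken) (e : Finset Plane) (s : Side) : ℝ :=
  P.σn * B.avg / length (hull e) ^ 3 * lineInt (I.part e s) (fun x => eJump0 M v e s x ^ 2)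

/-- Penalty for the normal derivative on the interface. -/
noncomputable def curveSlopeSq (v : Broken) (T : Finset Plane) : ℝ :=
  P.σu * B.avg / diamT T * I.curveInt (hull T) (fun t => jump1 I (v T) t ^ 2)

/-- Penalty for the values on the interface. -/
noncomputable def curveValueSq (v : Broken) (T : Finset Plane) : ℝ :=
  P.σn * B.avg / diamT T ^ 3 * I.curveInt (hull T) (fun t => jump0 I (v T) t ^ 2)

theorem bulkSq_nonneg (v : Broken) (T : Finset Plane) (s : Side) : 0 ≤ bulkSq I B v T s :=
  mul_nonneg (B.β_pos s).le (integral_nonneg (hessProd_self_nonneg _))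

theorem slopeSq_nonneg (v : Broken) (e : Finset Plane) (s : Side) : 0 ≤ slopeSq M I B P v e s :=
  mul_nonneg (div_nonneg (mul_nonneg P.σu_pos.le (B.β_pos s).le) (length_nonneg _))
    (lineInt_nonneg _ fun _ => sq_nonneg _)

theorem bendSq_nonneg (v : Broken) (e : Finset Plane) (s : Side) : 0 ≤ bendSq M I B P v e s :=
  mul_nonneg (mul_nonneg (mul_nonneg P.σF_pos.le (length_nonneg _)) (B.β_pos s).le)
    (lineInt_nonneg _ fun _ => sq_nonneg _)

theorem valueSq_nonneg (v : Broken) (e : Finset Plane) (s : Side) : 0 ≤ valueSq M I B P v e s :=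
  mul_nonneg (div_nonneg (mul_nonneg P.σn_pos.le B.avg_pos.le) (pow_nonneg (length_nonneg _) 3))
    (lineInt_nonneg _ fun _ => sq_nonneg _)

theorem curveSlopeSq_nonneg (v : Broken) (T : Finset Plane) : 0 ≤ curveSlopeSq I B P v T :=
  mul_nonneg (div_nonneg (mul_nonneg P.σu_pos.le B.avg_pos.le) (diamT_nonneg _))
    (I.curveInt_nonneg _ fun _ => sq_nonneg _)

theorem curveValueSq_nonneg (v : Broken) (T : Finset Plane) : 0 ≤ curveValueSq I B P v T :=
  mul_nonneg (div_nonneg (mul_nonneg P.σn_pos.le B.avg_pos.le) (pow_nonneg (diamT_nonneg _) 3))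
    (I.curveInt_nonneg _ fun _ => sq_nonneg _)

/-- A non-interface edge lies on one side, so `e^s` is either the whole edge or empty, and then the
integral is zero. Thus weights in `|e|` and in `|e^s|` are interchangeable, for any dependence `c`
on the length, and both kinds of edges can be treated together. -/
theorem length_hull_mul_lineInt {e : Finset Plane} (he : e ∈ I.intEdgesN M.toTriangulation)
    (s : Side) (c : ℝ → ℝ) (f : Plane → ℝ) :
    c (length (hull e)) * lineInt (I.part e s) f =
      c (length (I.part e s)) * lineInt (I.part e s) f := by
  rcases (I.part e s).eq_empty_or_nonempty with h | h
  · rw [h, lineInt_empty, mul_zero, mul_zero]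
  · rw [I.part_eq_hull he h]

theorem normSq_eq (v : Broken) : normSq M I B P v =
    ∑ T ∈ M.elems, ∑ s : Side, bulkSq I B v T s
    + ∑ e ∈ I.intEdgesN M.toTriangulation, ∑ s : Side, slopeSq M I B P v e s
    + ∑ T ∈ I.elemsI M.toTriangulation, curveSlopeSq I B P v T
    + ∑ e ∈ I.intEdgesI M.toTriangulation, ∑ s : Side, slopeSq M I B P v e s
    + ∑ e ∈ I.intEdgesNF M.toTriangulation, ∑ s : Side, bendSq M I B P v e s
    + ∑ e ∈ I.intEdgesI M.toTriangulation, ∑ s : Side, bendSq M I B P v e s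
    + ∑ e ∈ I.intEdgesI M.toTriangulation, ∑ s : Side, valueSq M I B P v e s
    + ∑ T ∈ I.elemsI M.toTriangulation, curveValueSq I B P v T := by
  unfold normSq
  congr 1
  · congr 1
    · congr 1
      · congr 1
        · congr 1
          · congr 1
            · congr 1
              refine Finset.sum_congr rfl fun e he => Finset.sum_congr rfl fun s _ => ?_
              exact length_hull_mul_lineInt M I he s (fun l => P.σu * B.β s / l) _
          · refine Finset.sum_congr rfl fun e he => ?_
            rw [Finset.mul_sum]
            refine Finset.sum_congr rfl fun s _ => ?_
            unfold slopeSq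
            ring
        · refine Finset.sum_congr rfl fun e he => Finset.sum_congr rfl fun s _ => ?_
          exact length_hull_mul_lineInt M I (I.intEdgesNF_subset _ he) s
            (fun l => P.σF * l * B.β s) _
      · refine Finset.sum_congr rfl fun e he => ?_
        rw [Finset.mul_sum]
        refine Finset.sum_congr rfl fun s _ => ?_
        unfold bendSq
        ring
    · refine Finset.sum_congr rfl fun e he => ?_
      rw [Finset.mul_sum]
      rfl

/-- The slope sum over all of `M.intEdges`, which the consistency terms need, is the sum of two
disjoint summands of the norm and therefore costs no factor. -/
theorem parts_le_normSq (v : Broken) :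
    0 ≤ normSq M I B P v ∧
    ∑ T ∈ M.elems, ∑ s : Side, bulkSq I B v T s ≤ normSq M I B P v ∧
    ∑ e ∈ I.intEdgesN M.toTriangulation, ∑ s : Side, slopeSq M I B P v e s ≤ normSq M I B P v ∧
    ∑ T ∈ I.elemsI M.toTriangulation, curveSlopeSq I B P v T ≤ normSq M I B P v ∧
    ∑ e ∈ I.intEdgesI M.toTriangulation, ∑ s : Side, slopeSq M I B P v e s ≤ normSq M I B P v ∧
    ∑ e ∈ M.intEdges, ∑ s : Side, slopeSq M I B P v e s ≤ normSq M I B P v ∧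
    ∑ e ∈ I.intEdgesNF M.toTriangulation, ∑ s : Side, bendSq M I B P v e s ≤ normSq M I B P v ∧
    ∑ e ∈ I.intEdgesI M.toTriangulation, ∑ s : Side, bendSq M I B P v e s ≤ normSq M I B P v ∧
    ∑ e ∈ I.intEdgesI M.toTriangulation, ∑ s : Side, valueSq M I B P v e s ≤ normSq M I B P v ∧
    ∑ T ∈ I.elemsI M.toTriangulation, curveValueSq I B P v T ≤ normSq M I B P v := by
  have h1 : 0 ≤ ∑ T ∈ M.elems, ∑ s : Side, bulkSq I B v T s :=
    Finset.sum_nonneg fun T _ => Finset.sum_nonneg fun s _ => bulkSq_nonneg I B v T s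
  have h2 : 0 ≤ ∑ e ∈ I.intEdgesN M.toTriangulation, ∑ s : Side, slopeSq M I B P v e s :=
    Finset.sum_nonneg fun T _ => Finset.sum_nonneg fun s _ => slopeSq_nonneg M I B P v T s
  have h3 : 0 ≤ ∑ T ∈ I.elemsI M.toTriangulation, curveSlopeSq I B P v T :=
    Finset.sum_nonneg fun T _ => curveSlopeSq_nonneg I B P v T
  have h4 : 0 ≤ ∑ e ∈ I.intEdgesI M.toTriangulation, ∑ s : Side, slopeSq M I B P v e s :=
    Finset.sum_nonneg fun T _ => Finset.sum_nonneg fun s _ => slopeSq_nonneg M I B P v T s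
  have h5 : 0 ≤ ∑ e ∈ I.intEdgesNF M.toTriangulation, ∑ s : Side, bendSq M I B P v e s :=
    Finset.sum_nonneg fun T _ => Finset.sum_nonneg fun s _ => bendSq_nonneg M I B P v T s
  have h6 : 0 ≤ ∑ e ∈ I.intEdgesI M.toTriangulation, ∑ s : Side, bendSq M I B P v e s :=
    Finset.sum_nonneg fun T _ => Finset.sum_nonneg fun s _ => bendSq_nonneg M I B P v T s
  have h7 : 0 ≤ ∑ e ∈ I.intEdgesI M.toTriangulation, ∑ s : Side, valueSq M I B P v e s :=
    Finset.sum_nonneg fun T _ => Finset.sum_nonneg fun s _ => valueSq_nonneg M I B P v T s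
  have h8 : 0 ≤ ∑ T ∈ I.elemsI M.toTriangulation, curveValueSq I B P v T :=
    Finset.sum_nonneg fun T _ => curveValueSq_nonneg I B P v T
  rw [normSq_eq, I.sum_intEdges]
  refine ⟨?_, ?_, ?_, ?_, ?_, ?_, ?_, ?_, ?_, ?_⟩ <;> linarith

theorem continuous_eJump0 (v : Broken) (e : Finset Plane) (s : Side) :
    Continuous (eJump0 M v e s) :=
  (continuous_val _).sub (continuous_val _)

theorem continuous_eJump1 (v : Broken) (e : Finset Plane) (s : Side) :
    Continuous (eJump1 M v e s) :=
  (continuous_dir1 _ _).sub (continuous_dir1 _ _)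

theorem continuous_eJump2 (v : Broken) (e : Finset Plane) (s : Side) :
    Continuous (eJump2 M v e s) :=
  (continuous_dir2 _ _ _).sub (continuous_dir2 _ _ _)

theorem continuous_eAvg2 (v : Broken) (e : Finset Plane) (s : Side) :
    Continuous (eAvg2 M B v e s) :=
  ((continuous_const.mul (continuous_dir2 _ _ _)).add
    (continuous_const.mul (continuous_dir2 _ _ _))).div_const 2

/-- Weighted square integral of the average of the second normal derivatives on `e^s`. -/
noncomputable def avgSq (v : Broken) (e : Finset Plane) (s : Side) : ℝ :=
  length (I.part e s) / (P.σu * B.β s) * lineInt (I.part e s) (fun x => eAvg2 M B v e s x ^ 2)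

theorem avgSq_nonneg (v : Broken) (e : Finset Plane) (s : Side) : 0 ≤ avgSq M I B P v e s :=
  mul_nonneg (div_nonneg (length_nonneg _) (mul_nonneg P.σu_pos.le (B.β_pos s).le))
    (lineInt_nonneg _ fun _ => sq_nonneg _)

/-- One consistency term. -/
theorem abs_lineInt_avg_mul_jump_le {e : Finset Plane} (he : e ∈ M.intEdges) (s : Side)
    (u v : Broken) :
    |lineInt (I.part e s) fun x => eAvg2 M B u e s x * eJump1 M v e s x| ≤
      √(avgSq M I B P u e s) * √(slopeSq M I B P v e s) := by
  have hcard := M.card_of_mem_intEdges he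
  have hc : 0 < P.σu * B.β s := mul_pos P.σu_pos (B.β_pos s)
  -- If `|e^s| = 0`, the penalty weight is `0` by the convention for division by zero, but the
  -- integral over a null set vanishes as well. Otherwise the weights `|e^s| / (σu β^s)` and `σu β^s
  -- / |e^s|` cancel.
  rcases (length_nonneg (I.part e s)).eq_or_lt with h0 | h0
  · have hm : (Measure.hausdorffMeasure 1 : Measure Plane) (I.part e s) = 0 :=
      (measureReal_eq_zero_iff (hausdorffMeasure_part_lt_top I hcard s).ne).1 h0.symm
    have : lineInt (I.part e s) (fun x => eAvg2 M B u e s x * eJump1 M v e s x) = 0 := by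
      unfold lineInt
      rw [Measure.restrict_eq_zero.2 hm, integral_zero_measure]
    rw [this, abs_zero]
    positivity
  · refine (abs_lineInt_mul_le I hcard s (continuous_eAvg2 M B u e s)
      (continuous_eJump1 M v e s)).trans (le_of_eq ?_)
    have hX : 0 ≤ lineInt (I.part e s) (fun x => eAvg2 M B u e s x ^ 2) :=
      lineInt_nonneg _ fun _ => sq_nonneg _
    rw [← Real.sqrt_mul hX, ← Real.sqrt_mul (avgSq_nonneg M I B P u e s)]
    congr 1
    have hu := P.σu_pos
    have hβ := B.β_pos s
    unfold avgSq slopeSq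
    field_simp

theorem sum_consistency_le (u v : Broken) {D : ℝ}
    (hD : ∑ e ∈ M.intEdges, ∑ s : Side, avgSq M I B P u e s ≤ D) :
    -∑ e ∈ M.intEdges, ∑ s : Side,
      lineInt (I.part e s) (fun x => eAvg2 M B u e s x * eJump1 M v e s x) ≤
      √D * √(normSq M I B P v) := by
  obtain ⟨-, -, -, -, -, h, -⟩ := parts_le_normSq M I B P v
  rw [← Finset.sum_neg_distrib]
  simp only [← Finset.sum_neg_distrib]
  refine (sum_sum_le_sqrt_mul_sqrt M.intEdges (avgSq_nonneg M I B P u) (slopeSq_nonneg M I B P v)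
    fun e he s => (neg_le_abs _).trans
      (abs_lineInt_avg_mul_jump_le M I B P he s u v)).trans ?_
  gcongr

end Terms

theorem lineInt_mono (I : Interface) {e : Finset Plane} (he : e.card = 2) (s : Side)
    {f g : Plane → ℝ} (hf : Continuous f) (hg : Continuous g) (h : ∀ x, f x ≤ g x) :
    lineInt (I.part e s) f ≤ lineInt (I.part e s) g :=
  integral_mono (integrableOn_part I he s hf) (integrableOn_part I he s hg) h

theorem lineInt_add_mul_sq (I : Interface) {e : Finset Plane} (he : e.card = 2) (s : Side)
    {f g : Plane → ℝ} (hf : Continuous f) (hg : Continuous g) (a b : ℝ) :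
    lineInt (I.part e s) (fun x => a * f x ^ 2 + b * g x ^ 2) =
      a * lineInt (I.part e s) (fun x => f x ^ 2) +
        b * lineInt (I.part e s) (fun x => g x ^ 2) := by
  have i1 : IntegrableOn (fun x => a * f x ^ 2) (I.part e s) (Measure.hausdorffMeasure 1) :=
    integrableOn_part I he s (continuous_const.mul (hf.pow 2))
  have i2 : IntegrableOn (fun x => b * g x ^ 2) (I.part e s) (Measure.hausdorffMeasure 1) :=
    integrableOn_part I he s (continuous_const.mul (hg.pow 2))
  simp only [lineInt]
  rw [integral_add i1 i2, integral_const_mul, integral_const_mul]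

/-! ### Averages of second normal derivatives -/

section Averages

variable {M : Mesh} {I : Interface} {B : Coeffs} {P : Penalty}

/-- The average is bounded by one of the one-sided derivatives and the jump. -/
theorem avgSq_le_add_bendSq {e : Finset Plane} (he : e ∈ M.intEdges) {s : Side} {v : Broken}
    {T : Finset Plane} (hT : T = M.first e ∨ T = M.second e) {C : ℝ}
    (h : length (I.part e s) * lineInt (I.part e s)
      (fun x => dir2 (M.edgeNormal e) (M.edgeNormal e) (v T s) x ^ 2) ≤
        C * ∫ x in I.part T s, hessProd (v T s) (v T s) x) :
    avgSq M I B P v e s ≤ 2 * C / P.σu * bulkSq I B v T s +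
      1 / (2 * P.σu * P.σF) * bendSq M I B P v e s := by
  have hcard := M.card_of_mem_intEdges he
  have hu := P.σu_pos
  have hF := P.σF_pos
  have hβ := B.β_pos s
  have hL := length_nonneg (I.part e s)
  have h1 : lineInt (I.part e s) (fun x => eAvg2 M B v e s x ^ 2) ≤
      (2 * B.β s ^ 2) * lineInt (I.part e s)
        (fun x => dir2 (M.edgeNormal e) (M.edgeNormal e) (v T s) x ^ 2) +
      (B.β s ^ 2 / 2) * lineInt (I.part e s) (fun x => eJump2 M v e s x ^ 2) := by
    rw [← lineInt_add_mul_sq I hcard s (continuous_dir2 _ _ _) (continuous_eJump2 M v e s)]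
    refine lineInt_mono I hcard s ((continuous_eAvg2 M B v e s).pow 2)
      ((continuous_const.mul ((continuous_dir2 _ _ _).pow 2)).add
        (continuous_const.mul ((continuous_eJump2 M v e s).pow 2))) fun x => ?_
    -- With one-sided values `a` and `b`, the average is `β (a - (a - b) / 2)` or `β (b + (a - b) /
    -- 2)`; apply `(x + y)² ≤ 2 x² + 2 y²`.
    unfold eAvg2 eJump2
    rcases hT with rfl | rfl
    · generalize dir2 _ _ (v (M.first e) s) x = a
      generalize dir2 _ _ (v (M.second e) s) x = b
      nlinarith [mul_nonneg (sq_nonneg (B.β s)) (sq_nonneg (a + (a - b) / 2))]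
    · generalize dir2 _ _ (v (M.first e) s) x = a
      generalize dir2 _ _ (v (M.second e) s) x = b
      nlinarith [mul_nonneg (sq_nonneg (B.β s)) (sq_nonneg (b + (b - a) / 2))]
  unfold avgSq bulkSq bendSq
  generalize lineInt (I.part e s) (fun x => eJump2 M v e s x ^ 2) = X at *
  generalize lineInt (I.part e s)
    (fun x => dir2 (M.edgeNormal e) (M.edgeNormal e) (v T s) x ^ 2) = Y at *
  generalize (∫ x in I.part T s, hessProd (v T s) (v T s) x) = Z at *
  generalize length (I.part e s) = L at *
  calc L / (P.σu * B.β s) * _ ≤ L / (P.σu * B.β s) * (2 * B.β s ^ 2 * Y + B.β s ^ 2 / 2 * X) :=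
        mul_le_mul_of_nonneg_left h1 (by positivity)
    _ = 2 * B.β s / P.σu * (L * Y) + L * B.β s / (2 * P.σu) * X := by field_simp
    _ ≤ 2 * B.β s / P.σu * (C * Z) + L * B.β s / (2 * P.σu) * X := by gcongr
    _ = _ := by field_simp

/-- The average is bounded by both one-sided derivatives. -/
theorem avgSq_le_add {e : Finset Plane} (he : e ∈ M.intEdges) {s : Side} {v : Broken} {C : ℝ}
    (h : ∀ T, T = M.first e ∨ T = M.second e → length (I.part e s) * lineInt (I.part e s)
      (fun x => dir2 (M.edgeNormal e) (M.edgeNormal e) (v T s) x ^ 2) ≤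
        C * ∫ x in I.part T s, hessProd (v T s) (v T s) x) :
    avgSq M I B P v e s ≤ C / P.σu *
      (bulkSq I B v (M.first e) s + bulkSq I B v (M.second e) s) / 2 := by
  have hcard := M.card_of_mem_intEdges he
  have hu := P.σu_pos
  have hβ := B.β_pos s
  have hL := length_nonneg (I.part e s)
  have h1 : lineInt (I.part e s) (fun x => eAvg2 M B v e s x ^ 2) ≤
      (B.β s ^ 2 / 2) * lineInt (I.part e s)
        (fun x => dir2 (M.edgeNormal e) (M.edgeNormal e) (v (M.first e) s) x ^ 2) +
      (B.β s ^ 2 / 2) * lineInt (I.part e s)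
        (fun x => dir2 (M.edgeNormal e) (M.edgeNormal e) (v (M.second e) s) x ^ 2) := by
    rw [← lineInt_add_mul_sq I hcard s (continuous_dir2 _ _ _) (continuous_dir2 _ _ _)]
    refine lineInt_mono I hcard s ((continuous_eAvg2 M B v e s).pow 2)
      ((continuous_const.mul ((continuous_dir2 _ _ _).pow 2)).add
        (continuous_const.mul ((continuous_dir2 _ _ _).pow 2))) fun x => ?_
    unfold eAvg2
    generalize dir2 _ _ (v (M.first e) s) x = a
    generalize dir2 _ _ (v (M.second e) s) x = b
    nlinarith [mul_nonneg (sq_nonneg (B.β s)) (sq_nonneg (a - b))]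
  have ha := h _ (Or.inl rfl)
  have hb := h _ (Or.inr rfl)
  unfold avgSq bulkSq
  generalize lineInt (I.part e s)
    (fun x => dir2 (M.edgeNormal e) (M.edgeNormal e) (v (M.first e) s) x ^ 2) = X at *
  generalize lineInt (I.part e s)
    (fun x => dir2 (M.edgeNormal e) (M.edgeNormal e) (v (M.second e) s) x ^ 2) = Y at *
  generalize (∫ x in I.part (M.first e) s, hessProd (v (M.first e) s) (v (M.first e) s) x) = Z at *
  generalize (∫ x in I.part (M.second e) s,
    hessProd (v (M.second e) s) (v (M.second e) s) x) = W at *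
  generalize length (I.part e s) = L at *
  calc L / (P.σu * B.β s) * _ ≤ L / (P.σu * B.β s) * (B.β s ^ 2 / 2 * X + B.β s ^ 2 / 2 * Y) :=
        mul_le_mul_of_nonneg_left h1 (by positivity)
    _ = B.β s / (2 * P.σu) * (L * X) + B.β s / (2 * P.σu) * (L * Y) := by field_simp
    _ ≤ B.β s / (2 * P.σu) * (C * Z) + B.β s / (2 * P.σu) * (C * W) := by gcongr
    _ = _ := by field_simp

theorem avgSq_eq_zero_of_empty {e : Finset Plane} {s : Side} (v : Broken)
    (h : I.part e s = ∅) : avgSq M I B P v e s = 0 := by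
  unfold avgSq
  rw [h, lineInt_empty, mul_zero]

end Averages

/-- The averages of the second normal derivatives are controlled by the norm. -/
theorem exists_sum_avgSq_le (p : ℕ) {ρ : ℝ} (hρ : 0 < ρ) (P : Penalty) :
    ∃ D : ℝ, 0 < D ∧ ∀ (M : Mesh) (Ω : Set Plane) (I : Interface) (B : Coeffs) (r : ℝ),
      M.ShapeRegular ρ → I.H2 M.toTriangulation → I.TubularRadius r → M.meshSize < r / 2 →
      ∀ v : Broken, InIFESpace M I B Ω p v →
        ∑ e ∈ M.intEdges, ∑ s : Side, avgSq M I B P v e s ≤ D * normSq M I B P v := by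
  classical
  obtain ⟨C, hC, hCle⟩ := exists_length_mul_lineInt_le p
    (K := 32 / ρ + 3) (by positivity)
  have hu := P.σu_pos
  have hF := P.σF_pos
  set a : ℝ := 2 * C / P.σu with ha
  set b : ℝ := 1 / (2 * P.σu * P.σF) with hb
  have ha0 : 0 < a := by positivity
  have hb0 : 0 < b := by positivity
  -- Each element is the first, or the second, neighbor of at most three edges, which gives `3 * a`
  -- twice. The two bending sums of the norm give `b` each.
  refine ⟨6 * a + 2 * b, by positivity, fun M Ω I B r hreg h2 hr hmesh v hv => ?_⟩
  have hsum : ∀ e s, 0 ≤ bulkSq I B v (M.first e) s + bulkSq I B v (M.second e) s := fun e s =>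
    add_nonneg (bulkSq_nonneg _ _ _ _ _) (bulkSq_nonneg _ _ _ _ _)
  have hedge : ∀ e ∈ M.intEdges, ∀ s, avgSq M I B P v e s ≤
      a * (bulkSq I B v (M.first e) s + bulkSq I B v (M.second e) s) +
        b * bendSq M I B P v e s := by
    intro e he s
    rcases (I.part e s).eq_empty_or_nonempty with hempty | hne
    · rw [avgSq_eq_zero_of_empty v hempty]
      exact add_nonneg (mul_nonneg ha0.le (hsum e s))
        (mul_nonneg hb0.le (bendSq_nonneg _ _ _ _ _ _ _))
    obtain ⟨T, hT, z, R, hR, hball, hsub, hlen⟩ :=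
      exists_ball_subset_part hρ hreg h2 hr hmesh he hne
    have hTm : T ∈ M.elems := by
      rcases hT with rfl | rfl
      · exact (M.first_mem e he).1
      · exact (M.second_mem e he).1
    refine (avgSq_le_add_bendSq he hT (hCle _ (hv.isP hTm s) _ (M.norm_edgeNormal_le e) I s T _ z R
      hR hball hsub hlen)).trans ?_
    have : bulkSq I B v T s ≤ bulkSq I B v (M.first e) s + bulkSq I B v (M.second e) s := by
      rcases hT with rfl | rfl
      · exact le_add_of_nonneg_right (bulkSq_nonneg _ _ _ _ _)
      · exact le_add_of_nonneg_left (bulkSq_nonneg _ _ _ _ _)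
    gcongr
  -- The case distinction reflects the norm, which contains the bending penalty on a non-interface
  -- edge only if the edge belongs to an interface element. Otherwise both neighbors are uncut and
  -- the jump is not needed.
  have hedgeN : ∀ e ∈ I.intEdgesN M.toTriangulation, ∀ s, avgSq M I B P v e s ≤
      a * (bulkSq I B v (M.first e) s + bulkSq I B v (M.second e) s) +
        b * (if ∃ T ∈ I.elemsI M.toTriangulation, e ⊆ T then bendSq M I B P v e s else 0) := by
    intro e heN s
    have he := I.intEdgesN_subset _ heN
    split_ifs with hex
    · exact hedge e he s
    rcases (I.part e s).eq_empty_or_nonempty with hempty | hne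
    · rw [avgSq_eq_zero_of_empty v hempty, mul_zero, add_zero]
      exact mul_nonneg ha0.le (hsum e s)
    have hdis : ∀ T ∈ M.elems, e ⊆ T → Disjoint (hull T) I.curve := fun T hT heT => by
      rw [disjoint_iff_inter_eq_empty, ← not_nonempty_iff_eq_empty]
      intro hn
      refine hex ⟨T, ?_, heT⟩
      unfold Interface.elemsI
      exact Finset.mem_filter.2 ⟨hT, hn⟩
    have h1 := avgSq_le_add (P := P) (B := B) (v := v) (C := C) he (s := s) (I := I)
      fun T hT => by
        have hTm : T ∈ M.elems ∧ e ⊆ T := by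
          rcases hT with rfl | rfl
          · exact M.first_mem e he
          · exact M.second_mem e he
        obtain ⟨z, R, hR, hball, hsub, hlen⟩ := exists_ball_subset_part_of_disjoint hρ hreg hTm.1
          (hdis T hTm.1 hTm.2) he hTm.2 hne
        exact hCle _ (hv.isP hTm.1 s) _ (M.norm_edgeNormal_le e) I s T _ z R hR hball hsub hlen
    have h3 : 0 ≤ C / P.σu *
        (bulkSq I B v (M.first e) s + bulkSq I B v (M.second e) s) :=
      mul_nonneg (by positivity) (hsum e s)
    rw [mul_zero, add_zero, ha, mul_div_assoc, mul_assoc]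
    linarith
  obtain ⟨-, hA, -, -, -, -, hNF, hI, -⟩ := parts_le_normSq M I B P v
  have hcount : ∀ F : Finset Plane → Finset Plane,
      (∀ e ∈ M.intEdges, F e ∈ M.elems ∧ e ⊆ F e) →
      ∑ e ∈ M.intEdges, ∑ s : Side, bulkSq I B v (F e) s ≤ 3 * normSq M I B P v := fun F hFe => by
    refine (M.sum_intEdges_le hFe (g := fun T => ∑ s : Side, bulkSq I B v T s)
      fun T => Finset.sum_nonneg fun s _ => bulkSq_nonneg _ _ _ _ _).trans ?_
    linarith
  have hc1 := hcount _ M.first_mem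
  have hc2 := hcount _ M.second_mem
  have hNF' : ∑ e ∈ I.intEdgesN M.toTriangulation, ∑ s : Side,
      (if ∃ T ∈ I.elemsI M.toTriangulation, e ⊆ T then bendSq M I B P v e s else 0) =
      ∑ e ∈ I.intEdgesNF M.toTriangulation, ∑ s : Side, bendSq M I B P v e s := by
    unfold Interface.intEdgesNF
    rw [Finset.sum_filter]
    refine Finset.sum_congr rfl fun e _ => ?_
    split_ifs <;> simp
  rw [I.sum_intEdges] at hc1 hc2
  rw [I.sum_intEdges]
  have s1 := Finset.sum_le_sum fun e he =>
    Finset.sum_le_sum fun s (_ : s ∈ (Finset.univ : Finset Side)) =>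
      hedge e (I.intEdgesI_subset M.toTriangulation he) s
  have s2 := Finset.sum_le_sum fun e he =>
    Finset.sum_le_sum fun s (_ : s ∈ (Finset.univ : Finset Side)) => hedgeN e he s
  simp only [Finset.sum_add_distrib, ← Finset.mul_sum] at s1 s2
  rw [hNF'] at s2
  have e1 := mul_le_mul_of_nonneg_left hc1 ha0.le
  have e2 := mul_le_mul_of_nonneg_left hc2 ha0.le
  have e3 := mul_le_mul_of_nonneg_left hNF hb0.le
  have e4 := mul_le_mul_of_nonneg_left hI hb0.le
  linarith

/-! ### Cauchy–Schwarz for the terms of the form -/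

section Symmetric

variable (M : Mesh) (I : Interface) (B : Coeffs) (P : Penalty)

theorem formA_le (u v : Broken) :
    formA M I B u v ≤ √(normSq M I B P u) * √(normSq M I B P v) := by
  obtain ⟨-, hu, -⟩ := parts_le_normSq M I B P u
  obtain ⟨-, hv, -⟩ := parts_le_normSq M I B P v
  have h := sum_sum_le_sqrt_mul_sqrt M.elems
    (a := fun T s => ∫ x in I.part T s, B.β s * hessProd (u T s) (v T s) x)
    (bulkSq_nonneg I B u) (bulkSq_nonneg I B v) fun T _ s => by
      rw [integral_const_mul]
      exact mul_le_sqrt_mul_sqrt (B.β_pos s).le (I.abs_integral_hessProd_le T s _ _)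
  exact h.trans (mul_le_mul (Real.sqrt_le_sqrt hu) (Real.sqrt_le_sqrt hv) (Real.sqrt_nonneg _)
    (Real.sqrt_nonneg _))

theorem sum_slope_le (E : Finset (Finset Plane)) (hE : E ⊆ M.intEdges) (u v : Broken) :
    ∑ e ∈ E, ∑ s : Side, P.σu * B.β s / length (I.part e s) *
      lineInt (I.part e s) (fun x => eJump1 M u e s x * eJump1 M v e s x) ≤
      √(∑ e ∈ E, ∑ s : Side, slopeSq M I B P u e s) *
        √(∑ e ∈ E, ∑ s : Side, slopeSq M I B P v e s) :=
  sum_sum_le_sqrt_mul_sqrt E (slopeSq_nonneg M I B P u) (slopeSq_nonneg M I B P v)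
    fun e he s => mul_le_sqrt_mul_sqrt
      (div_nonneg (mul_nonneg P.σu_pos.le (B.β_pos s).le) (length_nonneg _))
      (abs_lineInt_mul_le I (M.card_of_mem_intEdges (hE he)) s (continuous_eJump1 M u e s)
        (continuous_eJump1 M v e s))

theorem sum_bend_le (E : Finset (Finset Plane)) (hE : E ⊆ M.intEdges) (u v : Broken) :
    ∑ e ∈ E, ∑ s : Side, P.σF * length (I.part e s) * B.β s *
      lineInt (I.part e s) (fun x => eJump2 M u e s x * eJump2 M v e s x) ≤
      √(∑ e ∈ E, ∑ s : Side, bendSq M I B P u e s) *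
        √(∑ e ∈ E, ∑ s : Side, bendSq M I B P v e s) :=
  sum_sum_le_sqrt_mul_sqrt E (bendSq_nonneg M I B P u) (bendSq_nonneg M I B P v)
    fun e he s => mul_le_sqrt_mul_sqrt
      (mul_nonneg (mul_nonneg P.σF_pos.le (length_nonneg _)) (B.β_pos s).le)
      (abs_lineInt_mul_le I (M.card_of_mem_intEdges (hE he)) s (continuous_eJump2 M u e s)
        (continuous_eJump2 M v e s))

theorem sum_value_le (E : Finset (Finset Plane)) (hE : E ⊆ M.intEdges) (u v : Broken) :
    ∑ e ∈ E, ∑ s : Side, P.σn * B.avg / length (hull e) ^ 3 *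
      lineInt (I.part e s) (fun x => eJump0 M u e s x * eJump0 M v e s x) ≤
      √(∑ e ∈ E, ∑ s : Side, valueSq M I B P u e s) *
        √(∑ e ∈ E, ∑ s : Side, valueSq M I B P v e s) :=
  sum_sum_le_sqrt_mul_sqrt E (valueSq_nonneg M I B P u) (valueSq_nonneg M I B P v)
    fun e he s => mul_le_sqrt_mul_sqrt
      (div_nonneg (mul_nonneg P.σn_pos.le B.avg_pos.le) (pow_nonneg (length_nonneg _) 3))
      (abs_lineInt_mul_le I (M.card_of_mem_intEdges (hE he)) s (continuous_eJump0 M u e s)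
        (continuous_eJump0 M v e s))

theorem sum_curveSlope_le (E : Finset (Finset Plane)) (u v : Broken) :
    ∑ T ∈ E, P.σu * B.avg / diamT T *
      I.curveInt (hull T) (fun t => jump1 I (u T) t * jump1 I (v T) t) ≤
      √(∑ T ∈ E, curveSlopeSq I B P u T) * √(∑ T ∈ E, curveSlopeSq I B P v T) :=
  (Finset.sum_le_sum fun T _ => mul_le_sqrt_mul_sqrt
    (div_nonneg (mul_nonneg P.σu_pos.le B.avg_pos.le) (diamT_nonneg _))
    (I.abs_curveInt_mul_le (hull T) (I.continuous_jump1 (u T)) (I.continuous_jump1 (v T)))).trans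
    (Real.sum_sqrt_mul_sqrt_le E (curveSlopeSq_nonneg I B P u) (curveSlopeSq_nonneg I B P v))

theorem sum_curveValue_le (E : Finset (Finset Plane)) (u v : Broken) :
    ∑ T ∈ E, P.σn * B.avg / diamT T ^ 3 *
      I.curveInt (hull T) (fun t => jump0 I (u T) t * jump0 I (v T) t) ≤
      √(∑ T ∈ E, curveValueSq I B P u T) * √(∑ T ∈ E, curveValueSq I B P v T) :=
  (Finset.sum_le_sum fun T _ => mul_le_sqrt_mul_sqrt
    (div_nonneg (mul_nonneg P.σn_pos.le B.avg_pos.le) (pow_nonneg (diamT_nonneg _) 3))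
    (I.abs_curveInt_mul_le (hull T) (I.continuous_jump0 (u T)) (I.continuous_jump0 (v T)))).trans
    (Real.sum_sqrt_mul_sqrt_le E (curveValueSq_nonneg I B P u) (curveValueSq_nonneg I B P v))

theorem formJn_le (u v : Broken) :
    formJn M I B P u v ≤ 4 * (√(normSq M I B P u) * √(normSq M I B P v)) := by
  obtain ⟨-, -, -, -, -, -, u1, u2, u3, u4⟩ := parts_le_normSq M I B P u
  obtain ⟨-, -, -, -, -, -, v1, v2, v3, v4⟩ := parts_le_normSq M I B P v
  have hI := I.intEdgesI_subset M.toTriangulation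
  have hNF := (I.intEdgesNF_subset M.toTriangulation).trans (I.intEdgesN_subset M.toTriangulation)
  have e1 : ∑ e ∈ I.intEdgesI M.toTriangulation, ∑ s : Side, P.σF *
      (length (I.part e s) * B.β s *
        lineInt (I.part e s) (fun x => eJump2 M u e s x * eJump2 M v e s x)) =
      ∑ e ∈ I.intEdgesI M.toTriangulation, ∑ s : Side, P.σF * length (I.part e s) * B.β s *
        lineInt (I.part e s) (fun x => eJump2 M u e s x * eJump2 M v e s x) :=
    Finset.sum_congr rfl fun e _ => Finset.sum_congr rfl fun s _ => by ring
  have e2 : ∑ e ∈ I.intEdgesNF M.toTriangulation, ∑ s : Side, P.σF * length (hull e) * B.β s *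
        lineInt (I.part e s) (fun x => eJump2 M u e s x * eJump2 M v e s x) =
      ∑ e ∈ I.intEdgesNF M.toTriangulation, ∑ s : Side, P.σF * length (I.part e s) * B.β s *
        lineInt (I.part e s) (fun x => eJump2 M u e s x * eJump2 M v e s x) :=
    Finset.sum_congr rfl fun e he => Finset.sum_congr rfl fun s _ =>
      length_hull_mul_lineInt M I (I.intEdgesNF_subset _ he) s (fun l => P.σF * l * B.β s) _
  unfold formJn
  rw [e1, e2]
  simp only [Finset.mul_sum]
  have b1 := (sum_bend_le M I B P _ hI u v).trans
    (mul_le_mul (Real.sqrt_le_sqrt u2) (Real.sqrt_le_sqrt v2) (Real.sqrt_nonneg _)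
      (Real.sqrt_nonneg _))
  have b2 := (sum_bend_le M I B P _ hNF u v).trans
    (mul_le_mul (Real.sqrt_le_sqrt u1) (Real.sqrt_le_sqrt v1) (Real.sqrt_nonneg _)
      (Real.sqrt_nonneg _))
  have b3 := (sum_value_le M I B P _ hI u v).trans
    (mul_le_mul (Real.sqrt_le_sqrt u3) (Real.sqrt_le_sqrt v3) (Real.sqrt_nonneg _)
      (Real.sqrt_nonneg _))
  have b4 := (sum_curveValue_le I B P (I.elemsI M.toTriangulation) u v).trans
    (mul_le_mul (Real.sqrt_le_sqrt u4) (Real.sqrt_le_sqrt v4) (Real.sqrt_nonneg _)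
      (Real.sqrt_nonneg _))
  linarith

/-- Each of the two consistency sums contributes `√D`, and each of the three slope penalties
contributes `1`. -/
theorem formJu_le (u v : Broken) {D : ℝ} (hD0 : 0 ≤ D)
    (hu : ∑ e ∈ M.intEdges, ∑ s : Side, avgSq M I B P u e s ≤ D * normSq M I B P u)
    (hv : ∑ e ∈ M.intEdges, ∑ s : Side, avgSq M I B P v e s ≤ D * normSq M I B P v) :
    formJu M I B P u v ≤ (2 * √D + 3) * (√(normSq M I B P u) * √(normSq M I B P v)) := by
  obtain ⟨-, -, u1, u2, u3, -⟩ := parts_le_normSq M I B P u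
  obtain ⟨-, -, v1, v2, v3, -⟩ := parts_le_normSq M I B P v
  have e1 : ∑ e ∈ I.intEdgesN M.toTriangulation, ∑ s : Side, P.σu * B.β s / length (hull e) *
        lineInt (I.part e s) (fun x => eJump1 M u e s x * eJump1 M v e s x) =
      ∑ e ∈ I.intEdgesN M.toTriangulation, ∑ s : Side, P.σu * B.β s / length (I.part e s) *
        lineInt (I.part e s) (fun x => eJump1 M u e s x * eJump1 M v e s x) :=
    Finset.sum_congr rfl fun e he => Finset.sum_congr rfl fun s _ =>
      length_hull_mul_lineInt M I he s (fun l => P.σu * B.β s / l) _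
  have c1 := sum_consistency_le M I B P u v hu
  have c2 := sum_consistency_le M I B P v u hv
  rw [Real.sqrt_mul hD0] at c1 c2
  have b1 := (sum_slope_le M I B P _ (I.intEdgesN_subset M.toTriangulation) u v).trans
    (mul_le_mul (Real.sqrt_le_sqrt u1) (Real.sqrt_le_sqrt v1) (Real.sqrt_nonneg _)
      (Real.sqrt_nonneg _))
  have b2 := (sum_slope_le M I B P _ (I.intEdgesI_subset M.toTriangulation) u v).trans
    (mul_le_mul (Real.sqrt_le_sqrt u3) (Real.sqrt_le_sqrt v3) (Real.sqrt_nonneg _)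
      (Real.sqrt_nonneg _))
  have b3 := (sum_curveSlope_le I B P (I.elemsI M.toTriangulation) u v).trans
    (mul_le_mul (Real.sqrt_le_sqrt u2) (Real.sqrt_le_sqrt v2) (Real.sqrt_nonneg _)
      (Real.sqrt_nonneg _))
  unfold formJu
  rw [e1]
  linarith

end Symmetric

end ImmersedC0IP

theorem mainTheorem3 (p : ℕ) (hp : 1 ≤ p) (ρ : ℝ) (hρ : 0 < ρ) (P : ImmersedC0IP.Penalty) :
    ∃ C : ℝ, 0 < C ∧
      ∀ (M : ImmersedC0IP.Mesh) (Ω : Set ImmersedC0IP.Plane) (I : ImmersedC0IP.Interface)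
        (B : ImmersedC0IP.Coeffs) (r : ℝ),
        M.IsMeshOf Ω → M.ShapeRegular ρ → I.curve ⊆ Ω →
        I.H1 M.toTriangulation → I.H2 M.toTriangulation →
        I.TubularRadius r → M.meshSize < r / 2 →
        ∀ u v : ImmersedC0IP.Broken,
          ImmersedC0IP.InIFESpace M I B Ω p u → ImmersedC0IP.InIFESpace M I B Ω p v →
          ImmersedC0IP.form M I B P u v ≤
            C * ImmersedC0IP.meshNorm M I B P u * ImmersedC0IP.meshNorm M I B P v := by
  obtain ⟨D, hD, h⟩ := ImmersedC0IP.exists_sum_avgSq_le p hρ P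
  -- The sum of the constants `1`, `2 * √D + 3` and `4` of the three parts of the form.
  refine ⟨2 * √D + 8, by positivity,
    fun M Ω I B r _ hreg _ _ h2 hr hmesh u v hu hv => ?_⟩
  have h1 := ImmersedC0IP.formA_le M I B P u v
  have h3 := ImmersedC0IP.formJu_le M I B P u v hD.le (h M Ω I B r hreg h2 hr hmesh u hu)
    (h M Ω I B r hreg h2 hr hmesh v hv)
  have h4 := ImmersedC0IP.formJn_le M I B P u v
  unfold ImmersedC0IP.form ImmersedC0IP.meshNorm
  linarith
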